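/- Let $0<a\le\infty$, write $[-a,a]$ for $\{x\in\mathbb R:|x|\le a\}$ (all of $\mathbb R$ if $a=\infty$), and let $f$ be a complex-valued function that is complex analytic in $[-a,a]$, i.e. the restriction of a function $f(z)$ holomorphic on an open subset of $\mathbb C$ containing $[-a,a]$. Let $\rho_0\in(0,\infty]$ be the distance from the origin to the nearest singularity of $f(z)$, i.e. the supremum of the radii $r$ such that $f(z)$ extends holomorphically to $|z|<r$. Notation. For real $\omega$ with $|\omega|<a<\infty$, $\operatorname{PV}\!\int_{-a}^a\frac{f(x)}{\omega-x}dx=\lim_{\varepsilon\to0^+}\big(\int_{-a}^{\omega-\varepsilon}+\int_{\omega+\varepsilon}^{a}\big)\frac{f(x)}{\omega-x}dx$. For $a<\infty$ the finite part $\operatorname{f.p.}\!\int_0^a \varphi(x)\,dx$ is $\lim_{\varepsilon\to0^+}C_\varepsilon$, where $\int_\varepsilon^a\varphi(x)\,dx=C_\varepsilon+D_\varepsilon$, $D_\varepsilon$ is a finite linear combination of $\ln\varepsilon$ and of powers $\varepsilon^{-p}$, $p>0$, and $C_\varepsilon$ converges. For $a=\infty$, principal values, finite parts and the integrals $\int_0^a$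 are the limits as $A\to\infty$ of those with $a$ replaced by $A$. If $a=\infty$, assume that $\operatorname{PV}\!\int_{-\infty}^{\infty}\frac{f(x)}{\omega-x}dx$ exists for every real $\omega$ with $|\omega|<\rho_0$. Then all finite parts, integrals and principal values below exist, the series converge, and the formulas hold for all real $\omega$ with $|\omega|<\min(a,\rho_0)$ (in particular for all real $\omega$ if $a=\infty$ and $f$ is entire, since then $\rho_0=\infty$); there is no singular (logarithmic) term. 1. $$\operatorname{PV}\!\int_{-a}^a\frac{f(x)}{\omega-x}dx=\sum_{k=0}^\infty\omega^k \operatorname{f.p.}\!\int_0^a \frac{(-1)^kf(-x)-f(x)}{x^{k+1}}dx .$$ 2. If $f$ is even, $$\operatorname{PV}\!\int_{-a}^a\frac{f(x)}{\omega-x}dx=-2\sum_{k=0}^\infty\omega^{2k+1} \operatorname{f.p.}\!\int_0^a \frac{f(x)}{x^{2k+2}}dx .$$ 3. If $f(x)=x^mg(x)$ on $[-a,a]$ with an integer $m\ge1$ and $g$ complex analytic in $[-a,a]$ (for instance if $f$ has a zero of order $m$ at $0$, so that $g(0)\ne0$), $$\operatorname{PV}\!\int_{-a}^a\frac{f(x)}{\omega-x}dx=\sum_{k=0}^{m-1}\omega^k\int_0^ax^{m-k-1}\big[(-1)^{k+m}g(-x)-g(x)\big]dx+\sum_{k=0}^\infty\omega^{k+m}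 \operatorname{f.p.}\!\int_0^a \frac{(-1)^kg(-x)-g(x)}{x^{k+1}}dx .$$ 4. If moreover $g$ is even, $$\operatorname{PV}\!\int_{-a}^a\frac{f(x)}{\omega-x}dx=-2\sum_{k=0}^\infty\omega^{2k+m+1} \operatorname{f.p.}\!\int_0^a \frac{g(x)}{x^{2k+2}}dx-2\sum_{k=0}^{\lfloor(m-1)/2\rfloor}\omega^{2k+1+2\lfloor m/2\rfloor-m}\int_0^ax^{2\lfloor(m-1)/2\rfloor-2k}g(x)\,dx .$$ -/

import Mathlib

open Filter Topology MeasureTheory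
open scoped NNReal ENNReal

/-- `[-a, a]` as a set of reals, for `a` a real number or `∞`. -/
def symmInterval (a : WithTop ℝ) : Set ℝ := {x : ℝ | ((|x| : ℝ) : WithTop ℝ) ≤ a}

/-- `F`, restricted to the open set `U ⊆ ℂ`, is a holomorphic extension of the function `f` on the
real set `I`. -/
def IsComplexExtension (f : ℝ → ℂ) (I : Set ℝ) (F : ℂ → ℂ) (U : Set ℂ) : Prop :=
  IsOpen U ∧ DifferentiableOn ℂ F U ∧ ∀ x ∈ I, (x : ℂ) ∈ U ∧ F x = f x

/-- `f` is complex analytic in `I`: it is the restriction to `I` of a function that is holomorphic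
in an open subset of the complex plane containing `I`. -/
def ComplexAnalyticIn (f : ℝ → ℂ) (I : Set ℝ) : Prop :=
  ∃ (F : ℂ → ℂ) (U : Set ℂ), IsComplexExtension f I F U

/-- The distance `ρ₀ ∈ [0, ∞]` from the origin to the nearest singularity of the complex extension
of `f`: the supremum of the radii `r` such that the extension of `f` from `I` is holomorphic in
the disc `|z| < r`. -/
noncomputable def singularityRadius (f : ℝ → ℂ) (I : Set ℝ) : ℝ≥0∞ :=
  ⨆ (r : ℝ≥0) (_ : ∃ (F : ℂ → ℂ) (U : Set ℂ),
    IsComplexExtension f I F U ∧ Metric.ball (0 : ℂ) r ⊆ U), (r : ℝ≥0∞)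

/-- Given the relation `Q A L` ("the integral with upper end point `A` has the value `L`") for
finite `A`, the same relation for an upper end point in `(0, ∞]`; the value at `∞` is the limit of
the values at `A` as `A → ∞`. -/
def ValueUpTo (Q : ℝ → ℂ → Prop) (a : WithTop ℝ) (L : ℂ) : Prop :=
  match a with
  | (A : ℝ) => Q A L
  | ⊤ => ∃ P : ℝ → ℂ, (∀ᶠ A in atTop, Q A (P A)) ∧ Tendsto P atTop (𝓝 L)

/-- `PV ∫_{-A}^{A} f(x) / (ω - x) dx` exists and equals `L`, for finite `A`
(used for `-A < ω < A`). -/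
def HasPVFinite (f : ℝ → ℂ) (ω A : ℝ) (L : ℂ) : Prop :=
  (∀ᶠ ε in 𝓝[>] (0 : ℝ),
    IntervalIntegrable (fun x : ℝ => f x / ((ω : ℂ) - (x : ℂ))) volume (-A) (ω - ε) ∧
    IntervalIntegrable (fun x : ℝ => f x / ((ω : ℂ) - (x : ℂ))) volume (ω + ε) A) ∧
  Tendsto (fun ε : ℝ =>
      (∫ x in (-A)..(ω - ε), f x / ((ω : ℂ) - (x : ℂ))) +
      (∫ x in (ω + ε)..A, f x / ((ω : ℂ) - (x : ℂ))))
    (𝓝[>] 0) (𝓝 L)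

/-- `PV ∫_{-a}^{a} f(x) / (ω - x) dx` exists and equals `L`, for `0 < a ≤ ∞`. -/
def HasPV (f : ℝ → ℂ) (ω : ℝ) (a : WithTop ℝ) (L : ℂ) : Prop :=
  ValueUpTo (HasPVFinite f ω) a L

/-- The finite part of `∫_0^A φ(x) dx` exists and equals `L`, for finite `A > 0`:
`∫_ε^A φ(x) dx = C_ε + D_ε`, where `D_ε` is a linear combination of negative powers of `ε` and of
`ln ε`, and `C_ε → L` as `ε → 0+`. -/
def HasFinitePartFinite (φ : ℝ → ℂ) (A : ℝ) (L : ℂ) : Prop :=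
  (∀ ε : ℝ, 0 < ε → ε < A → IntervalIntegrable φ volume ε A) ∧
  ∃ (s : Finset ℝ) (c : ℝ → ℂ) (b : ℂ), (∀ p ∈ s, 0 < p) ∧
    Tendsto (fun ε : ℝ => (∫ x in ε..A, φ x) -
        ((∑ p ∈ s, c p * ((ε ^ (-p) : ℝ) : ℂ)) + b * ((Real.log ε : ℝ) : ℂ)))
      (𝓝[>] 0) (𝓝 L)

/-- The finite part of `∫_0^a φ(x) dx` exists and equals `L`, for `0 < a ≤ ∞`. -/
def HasFinitePart (φ : ℝ → ℂ) (a : WithTop ℝ) (L : ℂ) : Prop :=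
  ValueUpTo (HasFinitePartFinite φ) a L

/-- The convergent integral `∫_0^a φ(x) dx` exists and equals `L`, for `0 < a ≤ ∞`
(as an improper integral if `a = ∞`). -/
def HasConvergentIntegral (φ : ℝ → ℂ) (a : WithTop ℝ) (L : ℂ) : Prop :=
  ValueUpTo (fun A L => IntervalIntegrable φ volume 0 A ∧ ∫ x in (0 : ℝ)..A, φ x = L) a L

/-! Let `H k` be the successive Taylor quotients of `f` at `0`, so that `x H_{k+1} = H_k - H_k(0)`,
with Taylor coefficients `α_n = H_n(0)`. Inserting `f = Σ_{n≤k} α_n xⁿ + x^{k+1} H_{k+1}` in the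
`k`-th integrand leaves the terms `-α_n (1 - (-1)^{k-n}) x^{-(k-n+1)}` and minus the even part
`H_{k+1}(x) + H_{k+1}(-x)`. The term `n = k`, the only one in `1/x`, has coefficient zero, so no
logarithm appears, and the finite part is an explicit number `V_k` (`hasFinitePartFinite_taylor`).

On a finite interval the principal value is `f(ω) log((A+ω)/(A-ω)) - ∫ q`, where `q` is the
difference quotient of `f` at `ω` (`hasPVFinite_of_quotient`). Here `q = Σ ω^k H_{k+1}`, while
`f(ω)` and the logarithm are power series in `ω`; their Cauchy product minus the integrated series
is `Σ ω^k V_k` (`hasSum_pv_taylor`). Convergence rests on `‖H k‖ ≤ C / δ^k` on the whole interval,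
even where it leaves the disc (`exists_taylor_quotients`).

For `a = ∞`, let `A → ∞`. The principal value at `ω = 0` is `V_0`, and the one at a single `ω ≠ 0`
then gives convergence of `V_1` (`exists_tendsto_finitePart_one`). Raising the order by `2j`
multiplies the tail integrand by `x^{-2j}`, so Abel's test handles the other orders, with bounds
uniform in `A` that allow the limit term by term (`tendsto_expansion_atTop`).

The other formulas follow from the general one: a factor `x^m` shifts the order by `m`, and evenness
makes every second integrand zero. -/

/-- A convergent linear combination of negative powers and the logarithm has limit zero. -/
lemma eq_zero_of_tendsto_polar (s : Finset ℝ) (c : ℝ → ℂ) (b l : ℂ) (hs : ∀ p ∈ s, 0 < p)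
    (h : Tendsto (fun ε : ℝ => (∑ p ∈ s, c p * ((ε ^ (-p) : ℝ) : ℂ)) +
      b * ((Real.log ε : ℝ) : ℂ)) (𝓝[>] 0) (𝓝 l)) : l = 0 := by
  induction s using Finset.induction_on_max with
  | empty =>
    simp only [Finset.sum_empty, zero_add] at h
    have hinv : Tendsto (fun ε : ℝ => (((Real.log ε)⁻¹ : ℝ) : ℂ)) (𝓝[>] 0) (𝓝 ((0 : ℝ) : ℂ)) :=
      (Complex.continuous_ofReal.tendsto _).comp
        (tendsto_inv_atBot_zero.comp Real.tendsto_log_nhdsGT_zero)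
    -- Division by `log ε → -∞` isolates `b`.
    have hb : b = 0 := by
      have h1 := h.mul hinv
      simp only [Complex.ofReal_zero, mul_zero] at h1
      refine tendsto_nhds_unique ((tendsto_const_nhds (x := b)).congr' ?_) h1
      filter_upwards [Ioo_mem_nhdsGT (show (0 : ℝ) < 1 by norm_num)] with ε hε
      have : ((Real.log ε : ℝ) : ℂ) ≠ 0 := by
        exact_mod_cast (Real.log_neg hε.1 hε.2).ne
      push_cast
      field_simp
    subst hb
    simp only [zero_mul] at h
    exact (tendsto_nhds_unique h tendsto_const_nhds)
  | insert a s has ih =>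
    have hna : a ∉ s := fun h => lt_irrefl _ (has a h)
    have ha : 0 < a := hs a (Finset.mem_insert_self _ _)
    have hpow : ∀ p : ℝ, 0 < p →
        Tendsto (fun ε : ℝ => ((ε ^ p : ℝ) : ℂ)) (𝓝[>] 0) (𝓝 ((0 : ℝ) : ℂ)) := by
      intro p hp
      refine (Complex.continuous_ofReal.tendsto _).comp ?_
      have := (Real.continuousAt_rpow_const 0 p (Or.inr hp.le)).tendsto
      rw [Real.zero_rpow hp.ne'] at this
      exact this.mono_left nhdsWithin_le_nhds
    -- `a` is the largest exponent, so multiplication by `ε ^ a` sends every other term to `0` and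
    -- isolates `c a`.
    have hca : c a = 0 := by
      have h1 := h.mul (hpow a ha)
      simp only [Complex.ofReal_zero, mul_zero] at h1
      have h2 : Tendsto (fun ε : ℝ => c a + (∑ p ∈ s, c p * ((ε ^ (a - p) : ℝ) : ℂ)) +
          b * ((Real.log ε * ε ^ a : ℝ) : ℂ)) (𝓝[>] 0)
          (𝓝 (c a + (∑ p ∈ s, c p * ((0 : ℝ) : ℂ)) + b * ((0 : ℝ) : ℂ))) := by
        refine (tendsto_const_nhds.add (tendsto_finsetSum _ fun p hp =>
          tendsto_const_nhds.mul (hpow _ (sub_pos.2 (has p hp))))).add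
          (tendsto_const_nhds.mul ?_)
        exact (Complex.continuous_ofReal.tendsto _).comp (tendsto_log_mul_rpow_nhdsGT_zero ha)
      simp only [Complex.ofReal_zero, mul_zero, Finset.sum_const_zero, add_zero] at h2
      refine tendsto_nhds_unique (h2.congr' ?_) h1
      filter_upwards [self_mem_nhdsWithin] with ε hε
      have hε' : (0 : ℝ) < ε := hε
      rw [Finset.sum_insert hna, add_mul, add_mul, Finset.sum_mul]
      congr 1
      · congr 1
        · rw [mul_assoc, ← Complex.ofReal_mul, ← Real.rpow_add hε']
          simp
        · refine Finset.sum_congr rfl fun p _ => ?_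
          rw [mul_assoc, ← Complex.ofReal_mul, ← Real.rpow_add hε']
          congr 3
          ring
      · push_cast
        ring
    refine ih (fun p hp => hs p (Finset.mem_insert_of_mem hp)) ?_
    simpa only [Finset.sum_insert hna, hca, zero_mul, zero_add] using h

/-! ### Calculus of finite parts on `(0, A]` -/

namespace HasFinitePartFinite

variable {φ ψ : ℝ → ℂ} {A B : ℝ} {L M : ℂ}

lemma add (h₁ : HasFinitePartFinite φ A L) (h₂ : HasFinitePartFinite ψ A M) (hA : 0 < A) :
    HasFinitePartFinite (fun x => φ x + ψ x) A (L + M) := by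
  obtain ⟨i₁, s, c, b, hs, t₁⟩ := h₁
  obtain ⟨i₂, s', c', b', hs', t₂⟩ := h₂
  classical
  refine ⟨fun ε h h' => (i₁ ε h h').add (i₂ ε h h'), s ∪ s',
    fun p => (if p ∈ s then c p else 0) + (if p ∈ s' then c' p else 0), b + b', ?_, ?_⟩
  · intro p hp
    rcases Finset.mem_union.1 hp with hp | hp
    exacts [hs p hp, hs' p hp]
  · refine (t₁.add t₂).congr' ?_
    filter_upwards [Ioo_mem_nhdsGT hA] with ε hε
    rw [intervalIntegral.integral_add (i₁ ε hε.1 hε.2) (i₂ ε hε.1 hε.2)]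
    simp only [add_mul, Finset.sum_add_distrib, ite_mul, zero_mul, Finset.sum_ite_mem]
    rw [Finset.inter_eq_right.2 Finset.subset_union_left,
      Finset.inter_eq_right.2 Finset.subset_union_right]
    ring

lemma const_mul (h : HasFinitePartFinite φ A L) (z : ℂ) :
    HasFinitePartFinite (fun x => z * φ x) A (z * L) := by
  obtain ⟨i, s, c, b, hs, t⟩ := h
  refine ⟨fun ε h h' => (i ε h h').const_mul z, s, fun p => z * c p, z * b, hs, ?_⟩
  refine (t.const_mul z).congr fun ε => ?_
  rw [intervalIntegral.integral_const_mul, mul_sub, mul_add, Finset.mul_sum]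
  simp only [mul_assoc]

lemma congr (h : HasFinitePartFinite φ A L) (hφ : ∀ x ∈ Set.Ioc 0 A, φ x = ψ x) (hA : 0 < A) :
    HasFinitePartFinite ψ A L := by
  obtain ⟨i, s, c, b, hs, t⟩ := h
  have key : ∀ ε : ℝ, 0 < ε → ε < A → Set.EqOn φ ψ (Set.uIoc ε A) := by
    intro ε h h' x hx
    rw [Set.uIoc_of_le h'.le] at hx
    exact hφ x ⟨h.trans hx.1, hx.2⟩
  refine ⟨fun ε h h' => (i ε h h').congr (key ε h h'), s, c, b, hs, t.congr' ?_⟩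
  filter_upwards [Ioo_mem_nhdsGT hA] with ε hε
  congr 1
  refine intervalIntegral.integral_congr_ae (Eventually.of_forall fun x hx => ?_)
  exact key ε hε.1 hε.2 hx

lemma of_intervalIntegrable (h : IntervalIntegrable φ volume 0 A) (hA : 0 < A) :
    HasFinitePartFinite φ A (∫ x in (0 : ℝ)..A, φ x) := by
  have hsub : ∀ ε : ℝ, 0 < ε → ε < A → Set.uIcc ε A ⊆ Set.uIcc 0 A := by
    intro ε h h'
    rw [Set.uIcc_of_le h'.le, Set.uIcc_of_le hA.le]
    exact Set.Icc_subset_Icc_left h.le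
  refine ⟨fun ε h1 h2 => h.mono_set (hsub ε h1 h2), ∅, 0, 0, by simp, ?_⟩
  simp only [Finset.sum_empty, zero_mul, add_zero, sub_zero]
  have hc : ContinuousOn (fun ε => ∫ x in ε..A, φ x) (Set.uIcc 0 A) := by
    have := intervalIntegral.continuousOn_primitive_interval' h.symm Set.left_mem_uIcc
    rw [Set.uIcc_comm] at this
    refine this.neg.congr fun x _ => ?_
    exact intervalIntegral.integral_symm _ _
  have h0 := hc 0 Set.left_mem_uIcc
  rw [Set.uIcc_of_le hA.le] at h0
  refine h0.tendsto.mono_left ?_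
  rw [← nhdsWithin_Ioo_eq_nhdsGT hA]
  exact nhdsWithin_mono _ Set.Ioo_subset_Icc_self

lemma eq_zero (h : HasFinitePartFinite (fun _ => 0) A L) : L = 0 := by
  obtain ⟨-, s, c, b, hs, t⟩ := h
  simp only [intervalIntegral.integral_zero, zero_sub] at t
  have := eq_zero_of_tendsto_polar s c b (-L) hs (by simpa using t.neg)
  simpa using this

/-- The difference is a finite part of the zero function, hence the limit of purely polar terms,
which `eq_zero_of_tendsto_polar` makes zero. -/
lemma unique (h₁ : HasFinitePartFinite φ A L) (h₂ : HasFinitePartFinite φ A M) (hA : 0 < A) :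
    L = M := by
  have h := h₁.add (h₂.const_mul (-1)) hA
  have h0 : L + -1 * M = 0 := (h.congr (fun x _ => by ring) hA).eq_zero
  linear_combination h0

/-- The polar terms depend only on `φ` near `0`, so they serve for both end points. -/
lemma extend (h : HasFinitePartFinite φ B L) (hB : 0 < B)
    (hi : ∀ ε : ℝ, 0 < ε → IntervalIntegrable φ volume ε A) :
    HasFinitePartFinite φ A (L + ∫ x in B..A, φ x) := by
  obtain ⟨i, s, c, b, hs, t⟩ := h
  refine ⟨fun ε h0 _ => hi ε h0, s, c, b, hs, ?_⟩
  refine (t.add_const _).congr' ?_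
  filter_upwards [Ioo_mem_nhdsGT hB] with ε hε
  rw [← intervalIntegral.integral_add_adjacent_intervals (i ε hε.1 hε.2) (hi B hB)]
  ring

lemma sum {ι : Type*} (s : Finset ι) {φ : ι → ℝ → ℂ} {L : ι → ℂ} (hA : 0 < A)
    (h : ∀ i ∈ s, HasFinitePartFinite (φ i) A (L i)) :
    HasFinitePartFinite (fun x => ∑ i ∈ s, φ i x) A (∑ i ∈ s, L i) := by
  classical
  induction s using Finset.induction_on with
  | empty =>
    have h0 : IntervalIntegrable (fun _ : ℝ => (0 : ℂ)) volume 0 A := intervalIntegrable_const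
    simpa using of_intervalIntegrable h0 hA
  | insert i s hi ih =>
    simp only [Finset.sum_insert hi]
    exact (h i (Finset.mem_insert_self _ _)).add
      (ih fun j hj => h j (Finset.mem_insert_of_mem hj)) hA

/-- The finite part of an inverse power other than `x⁻¹`. -/
lemma inv_pow (hA : 0 < A) {j : ℕ} (hj : j ≠ 0) :
    HasFinitePartFinite (fun x => ((x : ℂ) ^ (j + 1))⁻¹) A (-((j : ℂ) * (A : ℂ) ^ j)⁻¹) := by
  have hd : ∀ x : ℝ, x ≠ 0 →
      HasDerivAt (fun x : ℝ => -((j : ℂ) * (x : ℂ) ^ j)⁻¹) (((x : ℂ) ^ (j + 1))⁻¹) x := by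
    intro x hx
    have hx' : (x : ℂ) ≠ 0 := by exact_mod_cast hx
    have hj' : (j : ℂ) ≠ 0 := by exact_mod_cast hj
    have h1 : HasDerivAt (fun x : ℂ => -((j : ℂ) * x ^ j)⁻¹) (((x : ℂ) ^ (j + 1))⁻¹) (x : ℂ) := by
      refine (((hasDerivAt_pow j (x : ℂ)).const_mul (j : ℂ)).inv
        (by positivity)).neg.congr_deriv ?_
      obtain ⟨i, rfl⟩ := Nat.exists_eq_add_one_of_ne_zero hj
      rw [Nat.add_sub_cancel]
      field_simp
      ring
    exact h1.comp_ofReal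
  have hc : ∀ ε : ℝ, 0 < ε → ε < A →
      IntervalIntegrable (fun x : ℝ => ((x : ℂ) ^ (j + 1))⁻¹) volume ε A := by
    intro ε h h'
    refine ContinuousOn.intervalIntegrable (ContinuousOn.inv₀ (by fun_prop) fun x hx => ?_)
    rw [Set.uIcc_of_le h'.le] at hx
    have : (x : ℂ) ≠ 0 := by exact_mod_cast (h.trans_le hx.1).ne'
    positivity
  refine ⟨hc, {(j : ℝ)}, fun _ => (j : ℂ)⁻¹, 0, by simpa using Nat.pos_of_ne_zero hj, ?_⟩
  refine tendsto_const_nhds.congr' ?_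
  filter_upwards [Ioo_mem_nhdsGT hA] with ε hε
  rw [intervalIntegral.integral_eq_sub_of_hasDerivAt (fun x hx => hd x ?_) (hc ε hε.1 hε.2)]
  · rw [Finset.sum_singleton, Real.rpow_neg hε.1.le, Real.rpow_natCast]
    push_cast
    rw [mul_inv, mul_inv]
    ring
  · rw [Set.uIcc_of_le hε.2.le] at hx
    exact (hε.1.trans_le hx.1).ne'

end HasFinitePartFinite

/-! ### Taylor quotients and their geometric bound -/

open Function in
/-- The successive Taylor quotients at the origin of a function holomorphic in a neighbourhood of
a disc and of a real interval are bounded by a geometric sequence. -/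
lemma exists_taylor_quotients {F : ℂ → ℂ} {U : Set ℂ} {A δ r : ℝ} (hU : IsOpen U)
    (hF : DifferentiableOn ℂ F U) (hδ : 0 < δ) (hδr : δ < r) (hb : Metric.ball (0 : ℂ) r ⊆ U)
    (hI : ∀ x ∈ Set.Icc (-A) A, (x : ℂ) ∈ U) :
    ∃ (H : ℕ → ℝ → ℂ) (C : ℝ), (∀ x, H 0 x = F x) ∧
      (∀ k, ContinuousOn (H k) (Set.Icc (-A) A)) ∧
      (∀ (k : ℕ) (x : ℝ), (x : ℂ) * H (k + 1) x = H k x - H k 0) ∧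
      ∀ k, ∀ x ∈ Set.Icc (-A) A, ‖H k x‖ ≤ C / δ ^ k := by
  set G : ℕ → ℂ → ℂ := fun k => (swap dslope 0)^[k] F with hG
  have hGs : ∀ k, G (k + 1) = dslope (G k) 0 := fun k => by
    simp only [hG, iterate_succ_apply', swap]
  have hrel : ∀ k z, z * G (k + 1) z = G k z - G k 0 := fun k z => by
    rw [hGs]
    simpa using sub_smul_dslope (G k) 0 z
  have h0U : U ∈ 𝓝 (0 : ℂ) := hU.mem_nhds (hb (Metric.mem_ball_self (hδ.trans hδr)))
  have hd : ∀ k, DifferentiableOn ℂ (G k) U := by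
    intro k
    induction k with
    | zero => exact hF
    | succ k ih =>
      rw [hGs]
      exact (Complex.differentiableOn_dslope h0U).2 ih
  have hK : Metric.closedBall (0 : ℂ) δ ⊆ U :=
    (Metric.closedBall_subset_ball hδr).trans hb
  -- `r' < r` puts a closed disc inside `U`, as the Cauchy power series requires; `δ < r'` gives
  -- absolute convergence at `δ`.
  obtain ⟨r', hδr', hr'r⟩ := exists_between hδr
  have hr'0 : 0 < r' := hδ.trans hδr'
  lift r' to ℝ≥0 using hr'0.le
  obtain ⟨p, hps⟩ : ∃ p : FormalMultilinearSeries ℂ ℂ ℂ, HasFPowerSeriesOnBall F p 0 r' :=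
    ⟨_, (hF.mono ((Metric.closedBall_subset_ball hr'r).trans hb)).hasFPowerSeriesOnBall
      (by exact_mod_cast hr'0)⟩
  have hcoeff : ∀ k, p.coeff k = G k 0 := by
    intro k
    have h1 := hps.hasFPowerSeriesAt.has_fpower_series_iterate_dslope_fslope k
    have h2 := h1.coeff_zero (fun _ => 0)
    have h3 := p.coeff_iterate_fslope k 0
    rw [Nat.zero_add] at h3
    rw [← h3]
    change _ = (swap dslope 0)^[k] F 0
    rw [← h2]
    simp only [FormalMultilinearSeries.coeff]
    congr 1
    exact Subsingleton.elim _ _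
  have hsum : Summable fun n => ‖G n 0‖ * δ ^ n := by
    have h1 := hps.hasSum (y := (δ : ℂ)) (by
      rw [Metric.mem_eball, edist_zero_right]
      have : ‖(δ : ℂ)‖ < r' := by simpa [abs_of_pos hδ] using hδr'
      exact ENNReal.coe_lt_coe.2 this)
    refine h1.summable.norm.congr fun n => ?_
    rw [FormalMultilinearSeries.apply_eq_pow_smul_coeff, hcoeff, norm_smul, norm_pow,
      Complex.norm_real, Real.norm_of_nonneg hδ.le, mul_comm]
  have hpoly : ∀ k z, z ^ k * G k z = F z - ∑ n ∈ Finset.range k, G n 0 * z ^ n := by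
    intro k z
    induction k with
    | zero => simp [hG]
    | succ k ih =>
      rw [Finset.sum_range_succ, pow_succ, mul_assoc, hrel]
      linear_combination ih
  have hcomp : IsCompact (Metric.closedBall (0 : ℂ) δ ∪ (fun x : ℝ => (x : ℂ)) '' Set.Icc (-A) A) :=
    (isCompact_closedBall _ _).union (isCompact_Icc.image Complex.continuous_ofReal)
  obtain ⟨M, hM⟩ := hcomp.exists_bound_of_continuousOn (hF.continuousOn.mono
    (Set.union_subset hK (by rintro _ ⟨x, hx, rfl⟩; exact hI x hx)))
  set S := ∑' n, ‖G n 0‖ * δ ^ n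
  -- Off the open disc, `z ^ k * G k z` is `F z` minus a Taylor polynomial, and `‖z‖ ^ n ≤ δ ^ n *
  -- (‖z‖ / δ) ^ k` for `n < k` compares that polynomial with `S`.
  have hfar : ∀ k z, δ ≤ ‖z‖ → ‖F z‖ ≤ M → ‖G k z‖ ≤ (M + S) / δ ^ k := by
    intro k z hz hFz
    have hz0 : 0 < ‖z‖ := hδ.trans_le hz
    have hq : 1 ≤ ‖z‖ / δ := (one_le_div hδ).2 hz
    have h1 : ‖z‖ ^ k * ‖G k z‖ ≤ (M + S) * (‖z‖ / δ) ^ k := by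
      rw [← norm_pow, ← norm_mul, hpoly, add_mul]
      refine (norm_sub_le _ _).trans (add_le_add ?_ ?_)
      · exact hFz.trans (le_mul_of_one_le_right ((norm_nonneg _).trans hFz) (one_le_pow₀ hq))
      · refine (norm_sum_le _ _).trans ?_
        refine le_trans (Finset.sum_le_sum
          (g := fun n => ‖G n 0‖ * δ ^ n * (‖z‖ / δ) ^ k) fun n hn => ?_) ?_
        · rw [norm_mul, norm_pow, mul_assoc]
          refine mul_le_mul_of_nonneg_left ?_ (norm_nonneg _)
          calc ‖z‖ ^ n = δ ^ n * (‖z‖ / δ) ^ n := by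
                rw [← mul_pow, mul_div_cancel₀ _ hδ.ne']
            _ ≤ δ ^ n * (‖z‖ / δ) ^ k :=
                mul_le_mul_of_nonneg_left
                  (pow_le_pow_right₀ hq (Finset.mem_range.1 hn).le) (by positivity)
        · rw [← Finset.sum_mul]
          exact mul_le_mul_of_nonneg_right
            (hsum.sum_le_tsum _ fun n _ => by positivity) (by positivity)
    rw [div_pow, ← mul_div_assoc, mul_comm (M + S), mul_div_assoc] at h1
    exact le_of_mul_le_mul_left h1 (by positivity)
  refine ⟨fun k x => G k x, M + S, fun x => rfl, fun k => ?_, fun k x => ?_, fun k x hx => ?_⟩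
  · exact (hd k).continuousOn.comp Complex.continuous_ofReal.continuousOn hI
  · simpa using hrel k x
  · rcases le_total δ ‖(x : ℂ)‖ with h | h
    · exact hfar k x h (hM _ (Or.inr ⟨x, hx, rfl⟩))
    -- Near `0` one cannot divide by `z ^ k`; the maximum principle carries the bound inwards from
    -- the circle `‖z‖ = δ`.
    · refine Complex.norm_le_of_forall_mem_frontier_norm_le (U := Metric.ball (0 : ℂ) δ)
        Metric.isBounded_ball ?_ (fun z hz => ?_) ?_
      · exact ((hd k).mono (Metric.closure_ball_subset_closedBall.trans hK)).diffContOnCl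
      · rw [frontier_ball _ hδ.ne'] at hz
        have hz' : ‖z‖ = δ := by simpa using hz
        exact hfar k z hz'.ge (hM _ (Or.inl (Metric.sphere_subset_closedBall hz)))
      · rw [closure_ball _ hδ.ne']
        simpa using h

/-! ### Principal values and their expansion on a finite interval -/

lemma HasPVFinite.unique {f : ℝ → ℂ} {ω A : ℝ} {L M : ℂ} (h₁ : HasPVFinite f ω A L)
    (h₂ : HasPVFinite f ω A M) : L = M :=
  tendsto_nhds_unique h₁.2 h₂.2

/-- The principal value as an ordinary integral of the difference quotient plus a logarithm. -/
lemma hasPVFinite_of_quotient {f q : ℝ → ℂ} {ω A : ℝ} (hω : |ω| < A)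
    (hq : ContinuousOn q (Set.Icc (-A) A))
    (hrel : ∀ x ∈ Set.Icc (-A) A, ((x : ℂ) - ω) * q x = f x - f ω) :
    HasPVFinite f ω A (f ω * ((Real.log (A + ω) - Real.log (A - ω) : ℝ) : ℂ) -
      ∫ x in (-A)..A, q x) := by
  obtain ⟨hl, hr⟩ := abs_lt.1 hω
  have hqi : ∀ u v : ℝ, u ∈ Set.Icc (-A) A → v ∈ Set.Icc (-A) A →
      IntervalIntegrable q volume u v := fun u v hu hv =>
    (hq.mono (Set.uIcc_subset_Icc hu hv)).intervalIntegrable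
  have hinv : ∀ u v : ℝ, ω ∉ Set.uIcc u v →
      IntervalIntegrable (fun x : ℝ => ((ω : ℂ) - x)⁻¹) volume u v := by
    intro u v h
    refine ContinuousOn.intervalIntegrable (ContinuousOn.inv₀ (by fun_prop) fun x hx h0 => ?_)
    have : ω = x := by exact_mod_cast sub_eq_zero.1 h0
    exact h (this ▸ hx)
  have hint : ∀ u v : ℝ, ω ∉ Set.uIcc u v →
      ∫ x in u..v, ((ω : ℂ) - x)⁻¹ = ((Real.log (ω - u) - Real.log (ω - v) : ℝ) : ℂ) := by
    intro u v h
    -- `Real.log` is the logarithm of the absolute value, so one primitive serves on both sides of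
    -- `ω`.
    rw [intervalIntegral.integral_eq_sub_of_hasDerivAt
      (f := fun x : ℝ => ((-Real.log (ω - x) : ℝ) : ℂ)) (fun x hx => ?_) (hinv u v h)]
    · push_cast
      ring
    · have hne : ω - x ≠ 0 := fun h0 => h (by rwa [sub_eq_zero.1 h0])
      have := ((((hasDerivAt_id x).const_sub ω).log hne).neg).ofReal_comp
      refine this.congr_deriv ?_
      simp [div_eq_mul_inv]
  have hsplit : ∀ x ∈ Set.Icc (-A) A, x ≠ ω →
      f ω * ((ω : ℂ) - x)⁻¹ - q x = f x / ((ω : ℂ) - x) := by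
    intro x hx hne
    have h0 : (ω : ℂ) - x ≠ 0 := sub_ne_zero.2 (by exact_mod_cast hne.symm)
    rw [eq_div_iff h0, sub_mul, mul_assoc, inv_mul_cancel₀ h0]
    linear_combination hrel x hx
  have hon : ∀ u v : ℝ, u ∈ Set.Icc (-A) A → v ∈ Set.Icc (-A) A → ω ∉ Set.uIcc u v →
      Set.EqOn (fun x : ℝ => f ω * ((ω : ℂ) - x)⁻¹ - q x) (fun x => f x / ((ω : ℂ) - x))
        (Set.uIcc u v) := fun u v hu hv h x hx =>
    hsplit x (Set.uIcc_subset_Icc hu hv hx) fun h0 => h (h0 ▸ hx)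
  have hI : ∀ u v : ℝ, u ∈ Set.Icc (-A) A → v ∈ Set.Icc (-A) A → ω ∉ Set.uIcc u v →
      IntervalIntegrable (fun x : ℝ => f x / ((ω : ℂ) - x)) volume u v := fun u v hu hv h =>
    (((hinv u v h).const_mul _).sub (hqi u v hu hv)).congr
      ((hon u v hu hv h).mono Set.uIoc_subset_uIcc)
  have hV : ∀ u v : ℝ, u ∈ Set.Icc (-A) A → v ∈ Set.Icc (-A) A → ω ∉ Set.uIcc u v →
      ∫ x in u..v, f x / ((ω : ℂ) - x) =
        f ω * ((Real.log (ω - u) - Real.log (ω - v) : ℝ) : ℂ) - ∫ x in u..v, q x := by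
    intro u v hu hv h
    rw [← intervalIntegral.integral_congr (hon u v hu hv h), intervalIntegral.integral_sub
      ((hinv u v h).const_mul _) (hqi u v hu hv), intervalIntegral.integral_const_mul, hint u v h]
  have hAm : -A ∈ Set.Icc (-A) A := ⟨le_rfl, by linarith⟩
  have hAp : A ∈ Set.Icc (-A) A := ⟨by linarith, le_rfl⟩
  have hωm : ω ∈ Set.Icc (-A) A := ⟨hl.le, hr.le⟩
  have hev : ∀ᶠ ε in 𝓝[>] (0 : ℝ), 0 < ε ∧ -A < ω - ε ∧ ω + ε < A := by
    filter_upwards [Ioo_mem_nhdsGT (show 0 < min (A + ω) (A - ω) from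
      lt_min (by linarith) (by linarith))] with ε hε
    obtain ⟨h1, h2⟩ := lt_min_iff.1 hε.2
    exact ⟨hε.1, by linarith, by linarith⟩
  have hn1 : ∀ ε, 0 < ε → -A < ω - ε → ω ∉ Set.uIcc (-A) (ω - ε) := by
    intro ε h1 h2 h
    rw [Set.uIcc_of_le h2.le] at h
    linarith [h.2]
  have hn2 : ∀ ε, 0 < ε → ω + ε < A → ω ∉ Set.uIcc (ω + ε) A := by
    intro ε h1 h2 h
    rw [Set.uIcc_of_le h2.le] at h
    linarith [h.1]
  refine ⟨?_, ?_⟩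
  · filter_upwards [hev] with ε ⟨h0, h1, h2⟩
    exact ⟨hI _ _ hAm ⟨h1.le, by linarith⟩ (hn1 ε h0 h1),
      hI _ _ ⟨by linarith, h2.le⟩ hAp (hn2 ε h0 h2)⟩
  · have hc : ContinuousOn (fun t => ∫ x in (-A)..t, q x) (Set.uIcc (-A) A) :=
      intervalIntegral.continuousOn_primitive_interval' (hqi _ _ hAm hAp) Set.left_mem_uIcc
    have hca : ContinuousAt (fun t => ∫ x in (-A)..t, q x) ω :=
      hc.continuousAt (by rw [Set.uIcc_of_le (by linarith)]; exact Icc_mem_nhds hl hr)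
    have ht1 : Tendsto (fun ε : ℝ => ω - ε) (𝓝[>] 0) (𝓝 ω) :=
      tendsto_nhdsWithin_of_tendsto_nhds (by
        simpa using (tendsto_const_nhds (x := ω)).sub (tendsto_id (α := ℝ) (x := 𝓝 0)))
    have ht2 : Tendsto (fun ε : ℝ => ω + ε) (𝓝[>] 0) (𝓝 ω) :=
      tendsto_nhdsWithin_of_tendsto_nhds (by
        simpa using (tendsto_const_nhds (x := ω)).add (tendsto_id (α := ℝ) (x := 𝓝 0)))
    have h1 := hca.tendsto.comp ht1
    have h2 := hca.tendsto.comp ht2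
    have h3 := (tendsto_const_nhds (x := f ω * ((Real.log (A + ω) - Real.log (A - ω) : ℝ) : ℂ)
      - ∫ x in (-A)..A, q x)).add (h2.sub h1)
    rw [sub_self, add_zero] at h3
    refine h3.congr' ?_
    filter_upwards [hev] with ε ⟨h0, h1, h2⟩
    have hu : ω - ε ∈ Set.Icc (-A) A := ⟨h1.le, by linarith⟩
    have hv : ω + ε ∈ Set.Icc (-A) A := ⟨by linarith, h2.le⟩
    rw [hV _ _ hAm hu (hn1 ε h0 h1), hV _ _ hv hAp (hn2 ε h0 h2),
      ← intervalIntegral.integral_add_adjacent_intervals (hqi _ _ hAm hv) (hqi _ _ hv hAp)]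
    -- Both sides are `log ε`: the symmetric excision cancels the divergent terms exactly.
    have e1 : Real.log (ω - (ω + ε)) = Real.log (ω - (ω - ε)) := by
      rw [← Real.log_neg_eq_log]
      congr 1
      ring
    have e2 : Real.log (ω - A) = Real.log (A - ω) := by
      rw [← Real.log_neg_eq_log, neg_sub]
    rw [e1, e2, show ω - -A = A + ω by ring]
    simp only [Function.comp_apply]
    push_cast
    ring

/-- The logarithm in the principal value of `1 / (ω - x)`, as a power series. -/
lemma hasSum_log_sub_log {ω A : ℝ} (hω : |ω| < A) :
    HasSum (fun l : ℕ => (1 - (-1) ^ l) * (((l : ℂ) * (A : ℂ) ^ l)⁻¹ * (ω : ℂ) ^ l))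
      ((Real.log (A + ω) - Real.log (A - ω) : ℝ) : ℂ) := by
  have hA : 0 < A := (abs_nonneg _).trans_lt hω
  obtain ⟨hl, hr⟩ := abs_lt.1 hω
  have hz : ‖((ω / A : ℝ) : ℂ)‖ < 1 := by
    rw [Complex.norm_real, Real.norm_eq_abs, abs_div, abs_of_pos hA]
    exact (div_lt_one hA).2 hω
  -- The series of `-log(1 - z) + log(1 + z)` at `z = ω / A`; the two copies of `log A` cancel.
  have h := (Complex.hasSum_taylorSeries_neg_log hz).sub
    (Complex.hasSum_taylorSeries_neg_log (z := -((ω / A : ℝ) : ℂ)) (by rwa [norm_neg]))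
  convert! h using 1
  · funext l
    rw [neg_pow (((ω / A : ℝ) : ℂ)) l, Complex.ofReal_div, div_pow, mul_inv]
    ring
  · have h1 : (0 : ℝ) ≤ 1 - ω / A := by
      rw [sub_nonneg]
      exact (div_le_one hA).2 hr.le
    have h2 : (0 : ℝ) ≤ 1 + ω / A := by
      rw [show 1 + ω / A = (A + ω) / A by field_simp]
      exact div_nonneg (by linarith) hA.le
    have e1 : Real.log (1 - ω / A) = Real.log (A - ω) - Real.log A := by
      rw [← Real.log_div (by linarith) hA.ne']
      congr 1
      field_simp
    have e2 : Real.log (1 + ω / A) = Real.log (A + ω) - Real.log A := by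
      rw [← Real.log_div (by linarith) hA.ne']
      congr 1
      field_simp
    rw [sub_neg_eq_add, sub_neg_eq_add, show (1 : ℂ) - ((ω / A : ℝ) : ℂ) = ((1 - ω / A : ℝ) : ℂ) by push_cast; rfl,
      show (1 : ℂ) + ((ω / A : ℝ) : ℂ) = ((1 + ω / A : ℝ) : ℂ) by push_cast; rfl,
      ← Complex.ofReal_log h1, ← Complex.ofReal_log h2, e1, e2]
    push_cast
    ring

/-- At `j = 0` the factor `1 - (-1) ^ j` vanishes, which removes `1 / x`, the one power that would
produce a logarithm. -/
lemma hasFinitePartFinite_odd_inv_pow {A : ℝ} (hA : 0 < A) (j : ℕ) :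
    HasFinitePartFinite (fun x => (1 - (-1) ^ j) * ((x : ℂ) ^ (j + 1))⁻¹) A
      ((1 - (-1) ^ j) * -((j : ℂ) * (A : ℂ) ^ j)⁻¹) := by
  rcases eq_or_ne j 0 with rfl | hj
  · have h0 : IntervalIntegrable (fun _ : ℝ => (0 : ℂ)) volume 0 A := intervalIntegrable_const
    simpa using HasFinitePartFinite.of_intervalIntegrable h0 hA
  · exact (HasFinitePartFinite.inv_pow hA hj).const_mul _

section TaylorQuotients

variable {H : ℕ → ℝ → ℂ} {A : ℝ}

lemma taylor_quotient_expansion (hrel : ∀ (k : ℕ) (x : ℝ), (x : ℂ) * H (k + 1) x = H k x - H k 0)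
    (k : ℕ) (x : ℝ) :
    H 0 x = (∑ n ∈ Finset.range k, H n 0 * (x : ℂ) ^ n) + (x : ℂ) ^ k * H k x := by
  induction k with
  | zero => simp
  | succ k ih =>
    rw [ih, Finset.sum_range_succ, pow_succ, mul_assoc, hrel]
    ring

/-- As `k → ∞`, under the geometric bound, `ω ^ k * H k x` disappears and the Taylor sum tends to `H
0 ω`; hence `∑ ω ^ n * H (n + 1) x` is the difference quotient at `ω`. -/
lemma taylor_quotient_telescope
    (hrel : ∀ (k : ℕ) (x : ℝ), (x : ℂ) * H (k + 1) x = H k x - H k 0) (ω x : ℝ) (k : ℕ) :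
    ((x : ℂ) - ω) * ∑ n ∈ Finset.range k, (ω : ℂ) ^ n * H (n + 1) x =
      H 0 x - (ω : ℂ) ^ k * H k x - ∑ n ∈ Finset.range k, H n 0 * (ω : ℂ) ^ n := by
  induction k with
  | zero => simp
  | succ k ih =>
    rw [Finset.sum_range_succ, mul_add, ih, Finset.sum_range_succ]
    linear_combination (ω : ℂ) ^ k * hrel k x

/-- The finite parts in terms of the Taylor quotients. -/
lemma hasFinitePartFinite_taylor {f : ℝ → ℂ} (hA : 0 < A)
    (hH : ∀ x ∈ Set.Icc (-A) A, H 0 x = f x)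
    (hc : ∀ k, ContinuousOn (H k) (Set.Icc (-A) A))
    (hrel : ∀ (k : ℕ) (x : ℝ), (x : ℂ) * H (k + 1) x = H k x - H k 0) (k : ℕ) :
    HasFinitePartFinite (fun x : ℝ => ((-1) ^ k * f (-x) - f x) / (x : ℂ) ^ (k + 1)) A
      ((∑ n ∈ Finset.range (k + 1), H n 0 *
        ((1 - (-1) ^ (k - n)) * (((k - n : ℕ) : ℂ) * (A : ℂ) ^ (k - n))⁻¹)) -
        ∫ x in (-A)..A, H (k + 1) x) := by
  have hi : ∀ u v : ℝ, u ∈ Set.Icc (-A) A → v ∈ Set.Icc (-A) A →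
      IntervalIntegrable (H (k + 1)) volume u v := fun u v hu hv =>
    ((hc _).mono (Set.uIcc_subset_Icc hu hv)).intervalIntegrable
  have hAm : -A ∈ Set.Icc (-A) A := ⟨le_rfl, by linarith⟩
  have hAp : A ∈ Set.Icc (-A) A := ⟨by linarith, le_rfl⟩
  have h0 : (0 : ℝ) ∈ Set.Icc (-A) A := ⟨by linarith, hA.le⟩
  have hneg : IntervalIntegrable (fun x => H (k + 1) (-x)) volume 0 A := by
    refine ContinuousOn.intervalIntegrable ((hc (k + 1)).comp (by fun_prop) fun x hx => ?_)
    rw [Set.uIcc_of_le hA.le] at hx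
    exact ⟨by linarith [hx.2], by linarith [hx.1]⟩
  have h1 := HasFinitePartFinite.of_intervalIntegrable (hneg.add (hi 0 A h0 hAp)) hA
  have e1 : (∫ x in (0 : ℝ)..A, (H (k + 1) (-x) + H (k + 1) x)) = ∫ x in (-A)..A, H (k + 1) x := by
    rw [intervalIntegral.integral_add hneg (hi 0 A h0 hAp),
      intervalIntegral.integral_comp_neg (fun x => H (k + 1) x), neg_zero,
      intervalIntegral.integral_add_adjacent_intervals (hi _ _ hAm h0) (hi _ _ h0 hAp)]
  rw [e1] at h1
  have h2 := HasFinitePartFinite.sum (Finset.range (k + 1)) hA fun n _ =>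
    (hasFinitePartFinite_odd_inv_pow hA (k - n)).const_mul (-H n 0)
  have h3 := h2.add (h1.const_mul (-1)) hA
  have e2 : (∑ n ∈ Finset.range (k + 1), -H n 0 *
        ((1 - (-1) ^ (k - n)) * -(((k - n : ℕ) : ℂ) * (A : ℂ) ^ (k - n))⁻¹)) +
        -1 * ∫ x in (-A)..A, H (k + 1) x =
      (∑ n ∈ Finset.range (k + 1), H n 0 *
        ((1 - (-1) ^ (k - n)) * (((k - n : ℕ) : ℂ) * (A : ℂ) ^ (k - n))⁻¹)) -
        ∫ x in (-A)..A, H (k + 1) x := by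
    rw [neg_one_mul, ← sub_eq_add_neg]
    congr 1
    exact Finset.sum_congr rfl fun n _ => by ring
  rw [e2] at h3
  refine h3.congr (fun x hx => ?_) hA
  have hx0 : (x : ℂ) ≠ 0 := by exact_mod_cast hx.1.ne'
  rw [eq_div_iff (pow_ne_zero _ hx0), ← hH x ⟨by linarith [hx.1], hx.2⟩,
    ← hH (-x) ⟨by linarith [hx.2], by linarith [hx.1]⟩,
    taylor_quotient_expansion hrel (k + 1) x, taylor_quotient_expansion hrel (k + 1) (-x),
    add_mul, Finset.sum_mul, mul_add ((-1 : ℂ) ^ k), Finset.mul_sum, add_sub_add_comm, ← Finset.sum_sub_distrib]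
  -- Monomials are matched with monomials, and the remainder at `±x` with the folded integrand `H (k
  -- + 1) (-x) + H (k + 1) x`.
  congr 1
  · refine Finset.sum_congr rfl fun n hn => ?_
    obtain ⟨j, rfl⟩ := Nat.exists_eq_add_of_le (Nat.lt_succ_iff.1 (Finset.mem_range.1 hn))
    rw [Nat.add_sub_cancel_left, Complex.ofReal_neg, neg_pow (x : ℂ) n, pow_add (-1 : ℂ) n j,
      show n + j + 1 = (j + 1) + n by ring, pow_add (x : ℂ) (j + 1) n]
    have hs : ((-1 : ℂ) ^ n) * (-1) ^ n = 1 := by rw [← mul_pow]; simp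
    have hi : ((x : ℂ) ^ (j + 1))⁻¹ * (x : ℂ) ^ (j + 1) = 1 :=
      inv_mul_cancel₀ (pow_ne_zero _ hx0)
    linear_combination -H n 0 * (1 - (-1) ^ j) * (x : ℂ) ^ n * hi -
      H n 0 * (x : ℂ) ^ n * (-1) ^ j * hs
  · rw [Complex.ofReal_neg, neg_pow (x : ℂ) (k + 1), pow_succ (-1 : ℂ) k]
    have hs : ((-1 : ℂ) ^ k) * (-1) ^ k = 1 := by rw [← mul_pow]; simp
    linear_combination (x : ℂ) ^ (k + 1) * H (k + 1) (-x) * hs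

/-- The expansion of the principal value in terms of the Taylor quotients. -/
lemma hasSum_pv_taylor {q : ℝ → ℂ} {C δ ω : ℝ} (hδ : |ω| < δ) (hω : |ω| < A)
    (hc : ∀ k, ContinuousOn (H k) (Set.Icc (-A) A))
    (hrel : ∀ (k : ℕ) (x : ℝ), (x : ℂ) * H (k + 1) x = H k x - H k 0)
    (hb : ∀ k, ∀ x ∈ Set.Icc (-A) A, ‖H k x‖ ≤ C / δ ^ k)
    (hq : ∀ x ∈ Set.Icc (-A) A, ((x : ℂ) - ω) * q x = H 0 x - H 0 ω) :
    HasSum (fun k : ℕ => (ω : ℂ) ^ k * ((∑ n ∈ Finset.range (k + 1), H n 0 *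
        ((1 - (-1) ^ (k - n)) * (((k - n : ℕ) : ℂ) * (A : ℂ) ^ (k - n))⁻¹)) -
        ∫ x in (-A)..A, H (k + 1) x))
      (H 0 ω * ((Real.log (A + ω) - Real.log (A - ω) : ℝ) : ℂ) - ∫ x in (-A)..A, q x) := by
  obtain ⟨hl, hr⟩ := abs_lt.1 hω
  have hA : 0 < A := (abs_nonneg _).trans_lt hω
  have hδ0 : 0 < δ := (abs_nonneg _).trans_lt hδ
  have h0 : (0 : ℝ) ∈ Set.Icc (-A) A := ⟨by linarith, hA.le⟩
  have hgeo : Summable fun k : ℕ => C * (|ω| / δ) ^ k :=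
    (summable_geometric_of_lt_one (by positivity) ((div_lt_one hδ0).2 hδ)).mul_left C
  have hbd : ∀ k, ∀ x ∈ Set.Icc (-A) A, ‖(ω : ℂ) ^ k * H k x‖ ≤ C * (|ω| / δ) ^ k := by
    intro k x hx
    rw [norm_mul, norm_pow, Complex.norm_real, Real.norm_eq_abs]
    calc |ω| ^ k * ‖H k x‖ ≤ |ω| ^ k * (C / δ ^ k) :=
          mul_le_mul_of_nonneg_left (hb k x hx) (by positivity)
      _ = C * (|ω| / δ) ^ k := by rw [div_pow]; ring
  have hrem : ∀ x ∈ Set.Icc (-A) A, Tendsto (fun k => (ω : ℂ) ^ k * H k x) atTop (𝓝 0) :=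
    fun x hx => squeeze_zero_norm (fun k => hbd k x hx) hgeo.tendsto_atTop_zero
  have hα : Summable fun n => ‖H n 0 * (ω : ℂ) ^ n‖ :=
    hgeo.of_nonneg_of_le (fun _ => norm_nonneg _) fun n => by
      rw [mul_comm]
      exact hbd n 0 h0
  have htay : HasSum (fun n => H n 0 * (ω : ℂ) ^ n) (H 0 ω) := by
    rw [hα.of_norm.hasSum_iff_tendsto_nat]
    have := (tendsto_const_nhds (x := H 0 ω)).sub (hrem ω ⟨hl.le, hr.le⟩)
    rw [sub_zero] at this
    refine this.congr fun k => ?_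
    linear_combination taylor_quotient_expansion hrel k ω
  have hbd' : ∀ k, ∀ x ∈ Set.Icc (-A) A,
      ‖(ω : ℂ) ^ k * H (k + 1) x‖ ≤ C / δ * (|ω| / δ) ^ k := by
    intro k x hx
    rw [norm_mul, norm_pow, Complex.norm_real, Real.norm_eq_abs]
    calc |ω| ^ k * ‖H (k + 1) x‖ ≤ |ω| ^ k * (C / δ ^ (k + 1)) :=
          mul_le_mul_of_nonneg_left (hb _ x hx) (by positivity)
      _ = C / δ * (|ω| / δ) ^ k := by rw [div_pow, pow_succ]; field_simp
  have hgeo' : Summable fun k : ℕ => C / δ * (|ω| / δ) ^ k :=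
    (summable_geometric_of_lt_one (by positivity) ((div_lt_one hδ0).2 hδ)).mul_left _
  -- The telescoped identity is divided by `x - ω`; the excluded point is null for the integral
  -- below.
  have hqs : ∀ x ∈ Set.Icc (-A) A, x ≠ ω →
      HasSum (fun k => (ω : ℂ) ^ k * H (k + 1) x) (q x) := by
    intro x hx hne
    have hne' : (x : ℂ) - ω ≠ 0 := sub_ne_zero.2 (by exact_mod_cast hne)
    rw [(hgeo'.of_norm_bounded fun k => hbd' k x hx).hasSum_iff_tendsto_nat]
    have h := (((tendsto_const_nhds (x := H 0 x)).sub (hrem x hx)).sub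
      htay.tendsto_sum_nat).const_mul (((x : ℂ) - ω)⁻¹)
    rw [sub_zero, ← hq x hx, inv_mul_cancel_left₀ hne'] at h
    refine h.congr fun k => ?_
    rw [← taylor_quotient_telescope hrel, inv_mul_cancel_left₀ hne']
  have hint : HasSum (fun k => ∫ x in (-A)..A, (ω : ℂ) ^ k * H (k + 1) x)
      (∫ x in (-A)..A, q x) := by
    have hsub : Set.uIoc (-A) A ⊆ Set.Icc (-A) A := by
      rw [Set.uIoc_of_le (by linarith)]
      exact Set.Ioc_subset_Icc_self
    refine intervalIntegral.hasSum_integral_of_dominated_convergence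
      (fun k _ => C / δ * (|ω| / δ) ^ k) (fun k => ?_)
      (fun k => Eventually.of_forall fun x hx => hbd' k x (hsub hx))
      (Eventually.of_forall fun x _ => hgeo') intervalIntegrable_const ?_
    · exact ((continuousOn_const.mul (hc (k + 1))).mono hsub).aestronglyMeasurable
        measurableSet_uIoc
    · filter_upwards [Measure.ae_ne volume ω] with x hne hx
      exact hqs x (hsub hx) hne
  have hlog := hasSum_log_sub_log hω
  -- The coefficient of `ω ^ k` in this Cauchy product is the boundary sum in the `k`-th finite
  -- part.
  have hprod := hasSum_sum_range_mul_of_summable_norm hα hlog.summable.norm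
  rw [htay.tsum_eq, hlog.tsum_eq] at hprod
  convert! hprod.sub hint using 1
  funext k
  rw [intervalIntegral.integral_const_mul, mul_sub, Finset.mul_sum]
  congr 1
  refine Finset.sum_congr rfl fun n hn => ?_
  have : (ω : ℂ) ^ k = (ω : ℂ) ^ n * (ω : ℂ) ^ (k - n) := by
    rw [← pow_add, Nat.add_sub_cancel' (Nat.lt_succ_iff.1 (Finset.mem_range.1 hn))]
  rw [this]
  ring

end TaylorQuotients

/-- The finite parts of a function analytic in a compact interval exist, and the principal values
are the sums of the power series that they generate. -/
lemma exists_finitePart_and_pv_expansion {f : ℝ → ℂ} {A : ℝ} (hA : 0 < A)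
    (hf : ComplexAnalyticIn f (Set.Icc (-A) A)) :
    ∃ V : ℕ → ℂ,
      (∀ k, HasFinitePartFinite
        (fun x : ℝ => ((-1) ^ k * f (-x) - f x) / (x : ℂ) ^ (k + 1)) A (V k)) ∧
      ∀ ω : ℝ, |ω| < A → (∃ (F : ℂ → ℂ) (U : Set ℂ) (r : ℝ),
        IsComplexExtension f (Set.Icc (-A) A) F U ∧ |ω| < r ∧ Metric.ball (0 : ℂ) r ⊆ U) →
        ∃ L, HasPVFinite f ω A L ∧ HasSum (fun k => (ω : ℂ) ^ k * V k) L := by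
  have main : ∀ ω : ℝ, |ω| < A → (∃ (F : ℂ → ℂ) (U : Set ℂ) (r : ℝ),
        IsComplexExtension f (Set.Icc (-A) A) F U ∧ |ω| < r ∧ Metric.ball (0 : ℂ) r ⊆ U) →
      ∃ V : ℕ → ℂ,
      (∀ k, HasFinitePartFinite
        (fun x : ℝ => ((-1) ^ k * f (-x) - f x) / (x : ℂ) ^ (k + 1)) A (V k)) ∧
        ∃ L, HasPVFinite f ω A L ∧ HasSum (fun k => (ω : ℂ) ^ k * V k) L := by
    rintro ω hω ⟨F, U, r, ⟨hU, hF, hI⟩, hr, hball⟩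
    obtain ⟨δ, hδ, hδr⟩ := exists_between hr
    obtain ⟨H, C, hH0, hc, hrel, hb⟩ := exists_taylor_quotients (A := A) hU hF
      ((abs_nonneg _).trans_lt hδ) hδr hball fun x hx => (hI x hx).1
    have hωI : ω ∈ Set.Icc (-A) A := ⟨(abs_lt.1 hω).1.le, (abs_lt.1 hω).2.le⟩
    have hHf : ∀ x ∈ Set.Icc (-A) A, H 0 x = f x := fun x hx => (hH0 x).trans (hI x hx).2
    have hqc : ContinuousOn (fun x : ℝ => dslope F ω x) (Set.Icc (-A) A) :=
      ((Complex.differentiableOn_dslope (hU.mem_nhds (hI ω hωI).1)).2 hF).continuousOn.comp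
        Complex.continuous_ofReal.continuousOn fun x hx => (hI x hx).1
    have hq : ∀ x : ℝ, ((x : ℂ) - ω) * dslope F ω x = H 0 x - H 0 ω := fun x => by
      rw [hH0, hH0]
      exact sub_smul_dslope F (ω : ℂ) x
    refine ⟨_, hasFinitePartFinite_taylor hA hHf hc hrel, _,
      hasPVFinite_of_quotient hω hqc fun x hx => ?_, ?_⟩
    · rw [hq, hHf x hx, hHf ω hωI]
    · rw [← hHf ω hωI]
      exact hasSum_pv_taylor hδ hω hc hrel hb fun x _ => hq x
  obtain ⟨F, U, hext⟩ := hf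
  have h0 := hext.2.2 0 ⟨by linarith, hA.le⟩
  obtain ⟨r, hr, hball⟩ := Metric.isOpen_iff.1 hext.1 _ h0.1
  obtain ⟨V, hV, -⟩ := main 0 (by simpa using hA)
    ⟨F, U, r, hext, by simpa using hr, by simpa using hball⟩
  refine ⟨V, hV, fun ω hω hω' => ?_⟩
  obtain ⟨V', hV', L, hL, hs⟩ := main ω hω hω'
  -- The coefficients found for `ω` come from an extension that varies with `ω`; uniqueness of
  -- finite parts shows that they do not depend on it.
  have : V' = V := funext fun k => (hV' k).unique (hV k) hA
  exact ⟨L, hL, this ▸ hs⟩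

/-! ### Passage to the infinite interval -/

/-- Abel's inequality for improper integrals with weight `x⁻ⁿ`. -/
lemma norm_integral_mul_inv_pow_le {h : ℝ → ℂ} {B M : ℝ} (hB : 0 < B)
    (hc : ContinuousOn h (Set.Ici B)) (hM : ∀ A, B ≤ A → ‖∫ x in B..A, h x‖ ≤ M) (n : ℕ) {A : ℝ}
    (hA : B ≤ A) : ‖∫ x in B..A, h x * ((x : ℂ) ^ n)⁻¹‖ ≤ M * (B ^ n)⁻¹ := by
  have hsub : Set.uIcc B A ⊆ Set.Ici B := by
    rw [Set.uIcc_of_le hA]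
    exact Set.Icc_subset_Ici_self
  have hpos : ∀ x ∈ Set.uIcc B A, 0 < x := fun x hx => hB.trans_le (hsub hx)
  have hhi : IntervalIntegrable h volume B A := (hc.mono hsub).intervalIntegrable
  set w' : ℝ → ℝ := fun x => -(n * x ^ (n - 1)) / (x ^ n) ^ 2 with hw'
  have hw : ∀ x : ℝ, 0 < x → HasDerivAt (fun x : ℝ => (x ^ n)⁻¹) (w' x) x := fun x hx =>
    (hasDerivAt_pow n x).inv (pow_pos hx n).ne'
  have hwi : IntervalIntegrable w' volume B A := by
    refine ContinuousOn.intervalIntegrable (ContinuousOn.div (by fun_prop) (by fun_prop) ?_)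
    intro x hx
    have := hpos x hx
    positivity
  have hvc : ContinuousOn (fun t => ∫ x in B..t, h x) (Set.uIcc B A) :=
    intervalIntegral.continuousOn_primitive_interval' hhi Set.left_mem_uIcc
  have hu : ∀ x : ℝ, 0 < x →
      HasDerivAt (fun x : ℝ => (((x ^ n)⁻¹ : ℝ) : ℂ)) ((w' x : ℝ) : ℂ) x :=
    fun x hx => (hw x hx).ofReal_comp
  -- The derivative falls on the decreasing weight `w`: the boundary term is at most `M w(A)` and
  -- the integral at most `M (w(B) - w(A))`, in total `M w(B)`.
  have hparts := intervalIntegral.integral_mul_deriv_eq_deriv_mul_of_hasDerivAt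
    (u := fun x : ℝ => (((x ^ n)⁻¹ : ℝ) : ℂ)) (u' := fun x => ((w' x : ℝ) : ℂ))
    (v := fun t => ∫ x in B..t, h x) (v' := h) (a := B) (b := A)
    (fun x hx => (hu x (hpos x hx)).continuousAt.continuousWithinAt) hvc
    (fun x hx => hu x (hpos x (Set.Ioo_subset_Icc_self hx)))
    (fun x hx => by
      rw [min_eq_left hA, max_eq_right hA] at hx
      have hx' : Set.Ici B ∈ 𝓝 x := Ici_mem_nhds hx.1
      refine intervalIntegral.integral_hasDerivAt_right ?_ ?_ (hc.continuousAt hx')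
      · refine hhi.mono_set ?_
        rw [Set.uIcc_of_le hx.1.le, Set.uIcc_of_le hA]
        exact Set.Icc_subset_Icc_right hx.2.le
      · exact (hc.mono Set.Ioi_subset_Ici_self).stronglyMeasurableAtFilter isOpen_Ioi x hx.1)
    ⟨hwi.1.ofReal, hwi.2.ofReal⟩ hhi
  have e : ∫ x in B..A, h x * ((x : ℂ) ^ n)⁻¹ = ∫ x in B..A, (((x ^ n)⁻¹ : ℝ) : ℂ) * h x := by
    refine intervalIntegral.integral_congr fun x _ => ?_
    push_cast
    ring
  rw [e, hparts, intervalIntegral.integral_same, mul_zero, sub_zero]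
  have hbd : ‖∫ x in B..A, ((w' x : ℝ) : ℂ) * ∫ t in B..x, h t‖ ≤
      ∫ x in B..A, -(M * w' x) := by
    refine intervalIntegral.norm_integral_le_of_norm_le hA (Eventually.of_forall fun x hx => ?_)
      (hwi.const_mul M).neg
    have hx0 : 0 < x := hB.trans hx.1
    have hneg : w' x ≤ 0 := by
      simp only [hw', neg_div]
      exact neg_nonpos.2 (by positivity)
    rw [norm_mul, Complex.norm_real, Real.norm_of_nonpos hneg]
    nlinarith [hM x hx.1.le]
  rw [intervalIntegral.integral_neg, intervalIntegral.integral_const_mul,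
    intervalIntegral.integral_eq_sub_of_hasDerivAt (fun x hx => hw x (hpos x hx)) hwi] at hbd
  have hA0 : 0 < A := hB.trans_le hA
  have h1 : ‖(((A ^ n)⁻¹ : ℝ) : ℂ) * ∫ x in B..A, h x‖ ≤ (A ^ n)⁻¹ * M := by
    rw [norm_mul, Complex.norm_real, Real.norm_of_nonneg (by positivity)]
    exact mul_le_mul_of_nonneg_left (hM A hA) (by positivity)
  refine (norm_sub_le _ _).trans ((add_le_add h1 hbd).trans_eq ?_)
  ring

/-- Abel's test for improper integrals with weight `x⁻ⁿ`. -/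
lemma exists_tendsto_integral_mul_inv_pow {h : ℝ → ℂ} {B : ℝ} {l : ℂ} (hB : 0 < B)
    (hc : ContinuousOn h (Set.Ici B))
    (hT : Tendsto (fun A => ∫ x in B..A, h x) atTop (𝓝 l)) (n : ℕ) :
    ∃ l', Tendsto (fun A => ∫ x in B..A, h x * ((x : ℂ) ^ n)⁻¹) atTop (𝓝 l') := by
  refine cauchySeq_tendsto_of_complete (Metric.cauchySeq_iff'.2 fun ε hε => ?_)
  obtain ⟨N, hN⟩ := Metric.cauchySeq_iff.1 hT.cauchySeq (ε / 2 * B ^ n) (by positivity)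
  have hi : ∀ u v, B ≤ u → B ≤ v → IntervalIntegrable h volume u v := fun u v hu hv =>
    (hc.mono fun x hx => (le_min hu hv).trans hx.1).intervalIntegrable
  have hi' : ∀ u v, B ≤ u → B ≤ v →
      IntervalIntegrable (fun x : ℝ => h x * ((x : ℂ) ^ n)⁻¹) volume u v := fun u v hu hv => by
    refine (hi u v hu hv).mul_continuousOn (ContinuousOn.inv₀ (by fun_prop) fun x hx => ?_)
    have : (x : ℂ) ≠ 0 := by exact_mod_cast (hB.trans_le ((le_min hu hv).trans hx.1)).ne'
    positivity
  have hBN : B ≤ max N B := le_max_right _ _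
  refine ⟨max N B, fun A hA => ?_⟩
  have hA' : max N B ≤ A := hA
  rw [dist_eq_norm, intervalIntegral.integral_interval_sub_left (hi' _ _ le_rfl (hBN.trans hA'))
    (hi' _ _ le_rfl hBN)]
  have hb := norm_integral_mul_inv_pow_le (hB.trans_le hBN)
    (hc.mono (Set.Ici_subset_Ici.2 hBN)) (M := ε / 2 * B ^ n) (fun t ht => by
      have := hN t ((le_max_left _ _).trans ht) (max N B) (le_max_left _ _)
      rw [dist_eq_norm, intervalIntegral.integral_interval_sub_left (hi _ _ le_rfl (hBN.trans ht))
        (hi _ _ le_rfl hBN)] at this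
      exact this.le) n hA'
  refine hb.trans_lt ?_
  calc ε / 2 * B ^ n * ((max N B) ^ n)⁻¹ ≤ ε / 2 * B ^ n * (B ^ n)⁻¹ := by gcongr
    _ = ε / 2 := by field_simp
    _ < ε := half_lt_self hε

/-- The added pieces avoid `ω`, and the reflection `x ↦ -x` folds the left one onto `[B, A]`. -/
lemma HasPVFinite.extend {f : ℝ → ℂ} {ω A B : ℝ} {L : ℂ} (hf : Continuous f)
    (h : HasPVFinite f ω B L) (hω : |ω| < B) (hBA : B ≤ A) :
    HasPVFinite f ω A
      (L + ∫ x in B..A, (f x / ((ω : ℂ) - x) + f (-x) / ((ω : ℂ) + x))) := by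
  obtain ⟨hl, hr⟩ := abs_lt.1 hω
  obtain ⟨hi, ht⟩ := h
  have hI : ∀ u v : ℝ, ω ∉ Set.uIcc u v →
      IntervalIntegrable (fun x : ℝ => f x / ((ω : ℂ) - x)) volume u v := by
    intro u v h
    refine ContinuousOn.intervalIntegrable
      (ContinuousOn.div hf.continuousOn (by fun_prop) fun x hx h0 => ?_)
    have : ω = x := by exact_mod_cast sub_eq_zero.1 h0
    exact h (this ▸ hx)
  have h1 : ω ∉ Set.uIcc (-A) (-B) := by
    rw [Set.uIcc_of_le (by linarith)]
    exact fun h => by linarith [h.2]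
  have h2 : ω ∉ Set.uIcc B A := by
    rw [Set.uIcc_of_le hBA]
    exact fun h => by linarith [h.1]
  have h3 : IntervalIntegrable (fun x : ℝ => f (-x) / ((ω : ℂ) + x)) volume B A := by
    have := (IntervalIntegrable.iff_comp_neg (f := fun x : ℝ => f x / ((ω : ℂ) - x))).1 (hI _ _ h1)
    simpa using this.symm
  have e3 : ∫ x in B..A, f (-x) / ((ω : ℂ) + x) = ∫ x in (-A)..(-B), f x / ((ω : ℂ) - x) := by
    rw [← intervalIntegral.integral_comp_neg (fun x : ℝ => f x / ((ω : ℂ) - x))]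
    simp
  rw [intervalIntegral.integral_add (hI _ _ h2) h3, e3]
  refine ⟨?_, (ht.add_const _).congr' ?_⟩
  · filter_upwards [hi] with ε hε
    exact ⟨(hI _ _ h1).trans hε.1, hε.2.trans (hI _ _ h2)⟩
  · filter_upwards [hi] with ε hε
    rw [← intervalIntegral.integral_add_adjacent_intervals (hI _ _ h1) hε.1,
      ← intervalIntegral.integral_add_adjacent_intervals hε.2 (hI _ _ h2)]
    ring

section FinitePartsToInfinity

variable {f : ℝ → ℂ} {V : ℝ → ℕ → ℂ}

lemma continuousOn_signed_quotient (hf : Continuous f) (k : ℕ) {B : ℝ} (hB : 0 < B) :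
    ContinuousOn (fun x : ℝ => ((-1) ^ k * f (-x) - f x) / (x : ℂ) ^ (k + 1)) (Set.Ici B) := by
  refine ContinuousOn.div (by fun_prop) (by fun_prop) fun x hx => ?_
  have : (x : ℂ) ≠ 0 := by exact_mod_cast (hB.trans_le hx).ne'
  positivity

lemma finitePart_sub_eq_integral (hf : Continuous f)
    (hV : ∀ A, 0 < A → ∀ k, HasFinitePartFinite
      (fun x : ℝ => ((-1) ^ k * f (-x) - f x) / (x : ℂ) ^ (k + 1)) A (V A k))
    {A B : ℝ} (hB : 0 < B) (hBA : B ≤ A) (k : ℕ) :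
    V A k = V B k + ∫ x in B..A, ((-1) ^ k * f (-x) - f x) / (x : ℂ) ^ (k + 1) := by
  have hA := hB.trans_le hBA
  refine (hV A hA k).unique ((hV B hB k).extend hB fun ε hε => ?_) hA
  exact ((continuousOn_signed_quotient hf k (lt_min hε hA)).mono
    fun x hx => hx.1).intervalIntegrable

lemma finitePart_sub_eq_integral_mul (hf : Continuous f)
    (hV : ∀ A, 0 < A → ∀ k, HasFinitePartFinite
      (fun x : ℝ => ((-1) ^ k * f (-x) - f x) / (x : ℂ) ^ (k + 1)) A (V A k))
    {A B : ℝ} (hB : 0 < B) (hBA : B ≤ A) (i j : ℕ) :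
    V A (i + 2 * j) = V B (i + 2 * j) +
      ∫ x in B..A, ((-1) ^ i * f (-x) - f x) / (x : ℂ) ^ (i + 1) * ((x : ℂ) ^ (2 * j))⁻¹ := by
  rw [finitePart_sub_eq_integral hf hV hB hBA]
  congr 1
  refine intervalIntegral.integral_congr fun x _ => ?_
  simp only [pow_add (-1 : ℂ) i, pow_mul (-1 : ℂ) 2, neg_one_sq, one_pow, mul_one]
  rw [show i + 2 * j + 1 = (i + 1) + 2 * j by ring, pow_add (x : ℂ), div_mul_eq_div_div,
    div_eq_mul_inv _ ((x : ℂ) ^ (2 * j))]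

lemma exists_tendsto_finitePart (hf : Continuous f)
    (hV : ∀ A, 0 < A → ∀ k, HasFinitePartFinite
      (fun x : ℝ => ((-1) ^ k * f (-x) - f x) / (x : ℂ) ^ (k + 1)) A (V A k))
    {i : ℕ} {l : ℂ} (hi : Tendsto (fun A => V A i) atTop (𝓝 l)) (j : ℕ) :
    ∃ l', Tendsto (fun A => V A (i + 2 * j)) atTop (𝓝 l') := by
  have h1 : Tendsto
      (fun A => ∫ x in (1 : ℝ)..A, ((-1) ^ i * f (-x) - f x) / (x : ℂ) ^ (i + 1)) atTop
      (𝓝 (l - V 1 i)) := by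
    refine (hi.sub_const (V 1 i)).congr' ?_
    filter_upwards [eventually_ge_atTop 1] with A hA
    rw [finitePart_sub_eq_integral hf hV one_pos hA]
    ring
  obtain ⟨l', hl'⟩ := exists_tendsto_integral_mul_inv_pow one_pos
    (continuousOn_signed_quotient hf i one_pos) h1 (2 * j)
  refine ⟨V 1 (i + 2 * j) + l', (hl'.const_add _).congr' ?_⟩
  filter_upwards [eventually_ge_atTop 1] with A hA
  rw [finitePart_sub_eq_integral_mul hf hV one_pos hA]

/-- Abel's inequality for the tail of order `i`, whose partial integrals from a late `B` stay below
`1`. The bound is uniform in `A` and `j`, which supplies a dominating series. -/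
lemma norm_finitePart_le (hf : Continuous f)
    (hV : ∀ A, 0 < A → ∀ k, HasFinitePartFinite
      (fun x : ℝ => ((-1) ^ k * f (-x) - f x) / (x : ℂ) ^ (k + 1)) A (V A k))
    {i : ℕ} {l : ℂ} (hi : Tendsto (fun A => V A i) atTop (𝓝 l)) :
    ∀ᶠ B : ℝ in atTop, ∀ A, B ≤ A → ∀ j,
      ‖V A (i + 2 * j)‖ ≤ ‖V B (i + 2 * j)‖ + (B ^ (2 * j))⁻¹ := by
  obtain ⟨N, hN⟩ := Metric.cauchySeq_iff.1 hi.cauchySeq 1 one_pos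
  filter_upwards [eventually_ge_atTop N, eventually_gt_atTop 0] with B hB hB0 A hA j
  have hb := norm_integral_mul_inv_pow_le hB0 (continuousOn_signed_quotient hf i hB0)
    (M := 1) (fun t ht => by
      have := hN t (hB.trans ht) B hB
      rw [dist_eq_norm, finitePart_sub_eq_integral hf hV hB0 ht, add_sub_cancel_left] at this
      exact this.le) (2 * j) hA
  rw [one_mul] at hb
  rw [finitePart_sub_eq_integral_mul hf hV hB0 hA]
  exact (norm_add_le _ _).trans (add_le_add_right hb _)

/-- Term-by-term passage to the limit in the expansion as the interval grows. -/
lemma tendsto_expansion_atTop (hf : Continuous f)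
    (hV : ∀ A, 0 < A → ∀ k, HasFinitePartFinite
      (fun x : ℝ => ((-1) ^ k * f (-x) - f x) / (x : ℂ) ^ (k + 1)) A (V A k))
    {c : ℕ → ℂ} (hc : ∀ k, Tendsto (fun A => V A k) atTop (𝓝 (c k))) {ω : ℝ}
    (hs : ∀ A, |ω| < A → Summable fun k => (ω : ℂ) ^ k * V A k) :
    Summable (fun k => (ω : ℂ) ^ k * c k) ∧
      Tendsto (fun A => ∑' k, (ω : ℂ) ^ k * V A k) atTop (𝓝 (∑' k, (ω : ℂ) ^ k * c k)) := by
  -- One `B` serves both parities of `k`; `|ω| < B` makes the dominating series converge, and `1 ≤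
  -- B` absorbs the parity offset `i ≤ 1` into the factor `B`.
  obtain ⟨B, hB0, hB1, hBω, hB⟩ := ((norm_finitePart_le hf hV (hc 0)).and
    ((norm_finitePart_le hf hV (hc 1)).and ((eventually_gt_atTop |ω|).and
      (eventually_ge_atTop 1)))).exists
  have hBpos : 0 < B := one_pos.trans_le hB
  have hbound : ∀ A, B ≤ A → ∀ k, ‖(ω : ℂ) ^ k * V A k‖ ≤
      ‖(ω : ℂ) ^ k * V B k‖ + B * (|ω| / B) ^ k := by
    intro A hA k
    obtain ⟨i, j, rfl, hi, hV'⟩ : ∃ i j, k = i + 2 * j ∧ i ≤ 1 ∧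
        ‖V A (i + 2 * j)‖ ≤ ‖V B (i + 2 * j)‖ + (B ^ (2 * j))⁻¹ := by
      rcases Nat.even_or_odd' k with ⟨j, rfl | rfl⟩
      · exact ⟨0, j, by ring, by norm_num, hB0 A hA j⟩
      · exact ⟨1, j, by ring, le_rfl, hB1 A hA j⟩
    have hpow : (B ^ (2 * j))⁻¹ ≤ B * (B ^ (i + 2 * j))⁻¹ := by
      rw [pow_add, mul_inv, ← mul_assoc]
      refine le_mul_of_one_le_left (by positivity) ?_
      rw [← div_eq_mul_inv, one_le_div (by positivity)]
      exact (pow_le_pow_right₀ hB hi).trans_eq (pow_one B)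
    rw [norm_mul, norm_mul, norm_pow, Complex.norm_real, Real.norm_eq_abs]
    calc |ω| ^ (i + 2 * j) * ‖V A (i + 2 * j)‖
        ≤ |ω| ^ (i + 2 * j) * (‖V B (i + 2 * j)‖ + B * (B ^ (i + 2 * j))⁻¹) := by
          refine mul_le_mul_of_nonneg_left (hV'.trans ?_) (by positivity)
          exact add_le_add_right hpow _
      _ = _ := by rw [div_pow]; ring
  have hsum : Summable fun k => ‖(ω : ℂ) ^ k * V B k‖ + B * (|ω| / B) ^ k :=
    (hs B hBω).norm.add ((summable_geometric_of_lt_one (by positivity)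
      ((div_lt_one hBpos).2 hBω)).mul_left B)
  have hlim : ∀ k, Tendsto (fun A => (ω : ℂ) ^ k * V A k) atTop (𝓝 ((ω : ℂ) ^ k * c k)) :=
    fun k => (hc k).const_mul _
  refine ⟨hsum.of_norm_bounded fun k => le_of_tendsto (hlim k).norm ?_,
    tendsto_tsum_of_dominated_convergence hsum hlim ?_⟩
  · filter_upwards [eventually_ge_atTop B] with A hA using hbound A hA k
  · filter_upwards [eventually_ge_atTop B] with A hA using hbound A hA

/-- Convergence of the finite part of order one from that of order zero and of the principal
value at one point `ω ≠ 0`. -/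
lemma exists_tendsto_finitePart_one (hf : Continuous f)
    (hV : ∀ A, 0 < A → ∀ k, HasFinitePartFinite
      (fun x : ℝ => ((-1) ^ k * f (-x) - f x) / (x : ℂ) ^ (k + 1)) A (V A k))
    {l L : ℂ} (h0 : Tendsto (fun A => V A 0) atTop (𝓝 l)) {ω : ℝ} (hω : ω ≠ 0)
    (hPV : HasPV f ω ⊤ L) : ∃ l', Tendsto (fun A => V A 1) atTop (𝓝 l') := by
  obtain ⟨P, hP, hPL⟩ := hPV
  obtain ⟨B, hPB, hB⟩ := (hP.and (eventually_gt_atTop |ω|)).exists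
  have hB0 : 0 < B := (abs_nonneg _).trans_lt hB
  obtain ⟨hl, hr⟩ := abs_lt.1 hB
  set ψ : ℝ → ℂ := fun x => f x / ((ω : ℂ) - x) + f (-x) / ((ω : ℂ) + x) with hψ
  have hne : ∀ x : ℝ, B ≤ x → (x : ℂ) ≠ 0 ∧ (ω : ℂ) - x ≠ 0 ∧ (ω : ℂ) + x ≠ 0 := by
    intro x hx
    refine ⟨?_, ?_, ?_⟩
    · exact_mod_cast (hB0.trans_le hx).ne'
    · exact_mod_cast (show ω - x < 0 by linarith).ne
    · exact_mod_cast (show 0 < ω + x by linarith).ne'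
  have hψc : ContinuousOn ψ (Set.Ici B) :=
    (ContinuousOn.div hf.continuousOn (by fun_prop) fun x hx => (hne x hx).2.1).add
      (ContinuousOn.div (by fun_prop) (by fun_prop) fun x hx => (hne x hx).2.2)
  have hψT : Tendsto (fun A => ∫ x in B..A, ψ x) atTop (𝓝 (L - P B)) := by
    refine (hPL.sub_const (P B)).congr' ?_
    filter_upwards [hP, eventually_ge_atTop B] with A hA hBA
    rw [hA.unique (hPB.extend hf hB hBA)]
    ring
  obtain ⟨m, hm⟩ := exists_tendsto_integral_mul_inv_pow hB0 hψc hψT 2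
  refine ⟨_, ((((hψT.sub (hm.const_mul ((ω : ℂ) ^ 2))).sub (h0.sub_const (V B 0))).const_mul
    ((ω : ℂ)⁻¹)).const_add (V B 1)).congr' ?_⟩
  filter_upwards [eventually_ge_atTop B] with A hA
  have hω' : (ω : ℂ) ≠ 0 := by exact_mod_cast hω
  have hsub : Set.uIcc B A ⊆ Set.Ici B := by
    rw [Set.uIcc_of_le hA]
    exact Set.Icc_subset_Ici_self
  have hi : ∀ k, IntervalIntegrable
      (fun x : ℝ => ((-1) ^ k * f (-x) - f x) / (x : ℂ) ^ (k + 1)) volume B A := fun k =>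
    ((continuousOn_signed_quotient hf k hB0).mono hsub).intervalIntegrable
  have hψi : IntervalIntegrable ψ volume B A := (hψc.mono hsub).intervalIntegrable
  have hψi' : IntervalIntegrable (fun x : ℝ => ψ x * ((x : ℂ) ^ 2)⁻¹) volume B A :=
    hψi.mul_continuousOn (ContinuousOn.inv₀ (by fun_prop) fun x hx =>
      pow_ne_zero _ (hne x (hsub hx)).1)
  -- Pointwise, `(1 - ω² / x²) ψ(x)` is `ω` times the integrand of order one plus that of order
  -- zero. Abel's test has handled `ψ / x²`, so only the order-one integral remains unknown.
  have key : (∫ x in B..A, ψ x) - (ω : ℂ) ^ 2 * ∫ x in B..A, ψ x * ((x : ℂ) ^ 2)⁻¹ =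
      (ω : ℂ) * (V A 1 - V B 1) + (V A 0 - V B 0) := by
    rw [finitePart_sub_eq_integral hf hV hB0 hA 1, finitePart_sub_eq_integral hf hV hB0 hA 0,
      add_sub_cancel_left, add_sub_cancel_left, ← intervalIntegral.integral_const_mul,
      ← intervalIntegral.integral_const_mul,
      ← intervalIntegral.integral_sub hψi (hψi'.const_mul _),
      ← intervalIntegral.integral_add ((hi 1).const_mul _) (hi 0)]
    refine intervalIntegral.integral_congr fun x hx => ?_
    obtain ⟨h1, h2, h3⟩ := hne x (hsub hx)
    simp only [hψ]
    field_simp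
    ring
  rw [key]
  field_simp
  ring

end FinitePartsToInfinity

/-! ### The general formula for `0 < a ≤ ∞` -/

lemma exists_extension_of_lt_singularityRadius {f : ℝ → ℂ} {I : Set ℝ} {ω : ℝ}
    (h : ENNReal.ofReal |ω| < singularityRadius f I) :
    ∃ (F : ℂ → ℂ) (U : Set ℂ) (r : ℝ),
      IsComplexExtension f I F U ∧ |ω| < r ∧ Metric.ball (0 : ℂ) r ⊆ U := by
  simp only [singularityRadius, lt_iSup_iff] at h
  obtain ⟨r, ⟨F, U, hext, hb⟩, hr⟩ := h
  refine ⟨F, U, r, hext, ?_, hb⟩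
  exact (ENNReal.ofReal_lt_coe_iff (abs_nonneg ω)).1 hr

lemma singularityRadius_pos {f : ℝ → ℂ} {I : Set ℝ} (hf : ComplexAnalyticIn f I) (h0 : 0 ∈ I) :
    0 < singularityRadius f I := by
  obtain ⟨F, U, hext⟩ := hf
  obtain ⟨r, hr, hball⟩ := Metric.isOpen_iff.1 hext.1 _ (hext.2.2 0 h0).1
  lift r to ℝ≥0 using hr.le
  simp only [singularityRadius, lt_iSup_iff]
  exact ⟨r, ⟨F, U, hext, by simpa using hball⟩, by exact_mod_cast hr⟩

lemma symmInterval_coe (A : ℝ) : symmInterval (A : WithTop ℝ) = Set.Icc (-A) A := by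
  ext x
  simp [symmInterval, abs_le]

lemma symmInterval_top : symmInterval ⊤ = Set.univ := by
  ext x
  simp [symmInterval]

lemma IsComplexExtension.mono {f : ℝ → ℂ} {I J : Set ℝ} {F : ℂ → ℂ} {U : Set ℂ}
    (h : IsComplexExtension f I F U) (hJ : J ⊆ I) : IsComplexExtension f J F U :=
  ⟨h.1, h.2.1, fun x hx => h.2.2 x (hJ hx)⟩

lemma ComplexAnalyticIn.continuousOn {f : ℝ → ℂ} {I : Set ℝ} (h : ComplexAnalyticIn f I) :
    ContinuousOn f I := by
  obtain ⟨F, U, -, hF, hI⟩ := h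
  exact (hF.continuousOn.comp Complex.continuous_ofReal.continuousOn
    fun x hx => (hI x hx).1).congr fun x hx => (hI x hx).2.symm

/-- The general expansion of the principal value by finite parts. -/
theorem exists_hasFinitePart_and_hasPV {a : WithTop ℝ} (ha : 0 < a) {f : ℝ → ℂ}
    (hf : ComplexAnalyticIn f (symmInterval a))
    (hPV : a = ⊤ → ∀ ω : ℝ, ENNReal.ofReal |ω| < singularityRadius f (symmInterval a) →
      ∃ L : ℂ, HasPV f ω a L) :
    ∃ c : ℕ → ℂ,
      (∀ k : ℕ, HasFinitePart
        (fun x : ℝ => ((-1) ^ k * f (-x) - f x) / (x : ℂ) ^ (k + 1)) a (c k)) ∧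
      ∀ ω : ℝ, ((|ω| : ℝ) : WithTop ℝ) < a →
        ENNReal.ofReal |ω| < singularityRadius f (symmInterval a) →
        ∃ L : ℂ, HasPV f ω a L ∧ HasSum (fun k : ℕ => (ω : ℂ) ^ k * c k) L := by
  induction a with
  | coe A =>
    have hA : 0 < A := by exact_mod_cast ha
    rw [symmInterval_coe] at hf ⊢
    obtain ⟨V, hV, h⟩ := exists_finitePart_and_pv_expansion hA hf
    exact ⟨V, hV, fun ω hω hr =>
      h ω (by exact_mod_cast hω) (exists_extension_of_lt_singularityRadius hr)⟩
  | top =>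
    replace hPV := hPV rfl
    rw [symmInterval_top] at hf hPV ⊢
    have hfc : Continuous f := continuousOn_univ.1 hf.continuousOn
    have hfA : ∀ A : ℝ, ComplexAnalyticIn f (Set.Icc (-A) A) := fun A => by
      obtain ⟨F, U, h⟩ := hf
      exact ⟨F, U, h.mono (Set.subset_univ _)⟩
    have hall : ∀ A : ℝ, ∃ V : ℕ → ℂ, 0 < A → (∀ k, HasFinitePartFinite
        (fun x : ℝ => ((-1) ^ k * f (-x) - f x) / (x : ℂ) ^ (k + 1)) A (V k)) ∧
        ∀ ω : ℝ, |ω| < A → ENNReal.ofReal |ω| < singularityRadius f Set.univ →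
        ∃ L, HasPVFinite f ω A L ∧ HasSum (fun k => (ω : ℂ) ^ k * V k) L := by
      intro A
      by_cases hA : 0 < A
      · obtain ⟨V, hV, h⟩ := exists_finitePart_and_pv_expansion hA (hfA A)
        refine ⟨V, fun _ => ⟨hV, fun ω hω hr => h ω hω ?_⟩⟩
        obtain ⟨F, U, r, hext, hr', hb⟩ := exists_extension_of_lt_singularityRadius hr
        exact ⟨F, U, r, hext.mono (Set.subset_univ _), hr', hb⟩
      · exact ⟨0, fun h => absurd h hA⟩
    choose V hall using hall
    have hV : ∀ A, 0 < A → ∀ k, HasFinitePartFinite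
      (fun x : ℝ => ((-1) ^ k * f (-x) - f x) / (x : ℂ) ^ (k + 1)) A (V A k) :=
      fun A hA => (hall A hA).1
    have hρ := singularityRadius_pos hf (Set.mem_univ 0)
    -- At `ω = 0` the finite-interval series reduces to its term `V A 0`.
    obtain ⟨c₀, hc₀⟩ : ∃ l, Tendsto (fun A => V A 0) atTop (𝓝 l) := by
      have h0 : ENNReal.ofReal |(0 : ℝ)| < singularityRadius f Set.univ := by simpa using hρ
      obtain ⟨L, P, hP, hPL⟩ := hPV 0 h0
      refine ⟨L, hPL.congr' ?_⟩
      filter_upwards [hP, eventually_gt_atTop 0] with A hPA hA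
      obtain ⟨M, hM, hs⟩ := (hall A hA).2 0 (by simpa using hA) h0
      rw [hPA.unique hM]
      refine hs.unique ?_
      convert! hasSum_single (f := fun k => ((0 : ℝ) : ℂ) ^ k * V A k) 0 ?_ using 1
      · simp
      · intro k hk
        simp [hk]
    obtain ⟨c₁, hc₁⟩ : ∃ l, Tendsto (fun A => V A 1) atTop (𝓝 l) := by
      obtain ⟨s, hs0, hs⟩ := ENNReal.lt_iff_exists_nnreal_btwn.1 hρ
      have hs0' : 0 < s := by exact_mod_cast hs0
      have hs1 : ENNReal.ofReal |(s : ℝ)| < singularityRadius f Set.univ := by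
        simpa using hs
      obtain ⟨L, hL⟩ := hPV s hs1
      exact exists_tendsto_finitePart_one hfc hV hc₀ (ω := s) (by exact_mod_cast hs0'.ne') hL
    have hcex : ∀ k, ∃ l, Tendsto (fun A => V A k) atTop (𝓝 l) := by
      intro k
      rcases Nat.even_or_odd' k with ⟨j, rfl | rfl⟩
      · simpa using exists_tendsto_finitePart hfc hV hc₀ j
      · simpa [add_comm] using exists_tendsto_finitePart hfc hV hc₁ j
    choose c hc using hcex
    refine ⟨c, fun k => ⟨fun A => V A k, ?_, hc k⟩, fun ω _ hω => ?_⟩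
    · filter_upwards [eventually_gt_atTop 0] with A hA using hV A hA k
    · have hfin : ∀ A, |ω| < A →
          HasPVFinite f ω A (∑' k, (ω : ℂ) ^ k * V A k) ∧
            Summable fun k => (ω : ℂ) ^ k * V A k := by
        intro A hA
        obtain ⟨L, hL, hs⟩ := (hall A ((abs_nonneg _).trans_lt hA)).2 ω hA hω
        exact ⟨by rwa [hs.tsum_eq], hs.summable⟩
      obtain ⟨h1, h2⟩ := tendsto_expansion_atTop hfc hV hc fun A hA => (hfin A hA).2
      refine ⟨_, ⟨fun A => ∑' k, (ω : ℂ) ^ k * V A k, ?_, h2⟩, h1.hasSum⟩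
      filter_upwards [eventually_gt_atTop |ω|] with A hA using (hfin A hA).1

/-! ### Transfer of integral identities to end points in `(0, ∞]` -/

lemma ValueUpTo.mono {Q Q' : ℝ → ℂ → Prop} {a : WithTop ℝ} {L : ℂ} (ha : 0 < a)
    (h : ValueUpTo Q a L)
    (hQ : ∀ A : ℝ, 0 < A → (A : WithTop ℝ) ≤ a → ∀ M, Q A M → Q' A M) : ValueUpTo Q' a L := by
  induction a with
  | coe A => exact hQ A (by exact_mod_cast ha) le_rfl L h
  | top =>
    obtain ⟨P, hP, hL⟩ := h
    refine ⟨P, ?_, hL⟩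
    filter_upwards [hP, eventually_gt_atTop 0] with A hA h0 using hQ A h0 le_top _ hA

lemma ValueUpTo.const_mul {Q Q' : ℝ → ℂ → Prop} {a : WithTop ℝ} {L : ℂ} (h : ValueUpTo Q a L)
    (z : ℂ) (hQ : ∀ A M, Q A M → Q' A (z * M)) : ValueUpTo Q' a (z * L) := by
  induction a with
  | coe A => exact hQ A L h
  | top =>
    obtain ⟨P, hP, hL⟩ := h
    exact ⟨fun A => z * P A, hP.mono fun A hA => hQ A _ hA, hL.const_mul z⟩

lemma ValueUpTo.eq_zero {Q : ℝ → ℂ → Prop} {a : WithTop ℝ} {L : ℂ} (ha : 0 < a)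
    (h : ValueUpTo Q a L) (hQ : ∀ A : ℝ, 0 < A → (A : WithTop ℝ) ≤ a → ∀ M, Q A M → M = 0) :
    L = 0 := by
  have h' := h.mono (Q' := fun _ M => M = 0) ha hQ
  induction a with
  | coe A => exact h'
  | top =>
    obtain ⟨P, hP, hL⟩ := h'
    exact tendsto_nhds_unique (hL.congr' hP) tendsto_const_nhds

lemma mem_symmInterval_of_mem_Icc {a : WithTop ℝ} {A x : ℝ} (hA : (A : WithTop ℝ) ≤ a)
    (hx : x ∈ Set.Icc (-A) A) : x ∈ symmInterval a :=
  le_trans (by exact_mod_cast abs_le.2 hx) hA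

lemma mem_symmInterval_of_mem_Ioc {a : WithTop ℝ} {A x : ℝ} (hA : (A : WithTop ℝ) ≤ a)
    (hx : x ∈ Set.Ioc 0 A) : x ∈ symmInterval a :=
  mem_symmInterval_of_mem_Icc hA ⟨by linarith [hx.1, hx.2], hx.2⟩

lemma neg_mem_symmInterval {a : WithTop ℝ} {x : ℝ} (hx : x ∈ symmInterval a) :
    -x ∈ symmInterval a := by
  simpa [symmInterval] using hx

section

variable {a : WithTop ℝ} {φ ψ : ℝ → ℂ} {L : ℂ}

lemma HasFinitePart.congr (ha : 0 < a) (h : HasFinitePart φ a L)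
    (hφ : ∀ x ∈ symmInterval a, 0 < x → φ x = ψ x) : HasFinitePart ψ a L :=
  h.mono ha fun _ hA hAa _ hM =>
    hM.congr (fun x hx => hφ x (mem_symmInterval_of_mem_Ioc hAa hx) hx.1) hA

lemma HasFinitePart.const_mul (h : HasFinitePart φ a L) (z : ℂ) :
    HasFinitePart (fun x => z * φ x) a (z * L) :=
  ValueUpTo.const_mul h z fun _ _ hM => hM.const_mul z

lemma HasFinitePart.eq_zero (ha : 0 < a) (h : HasFinitePart φ a L)
    (hφ : ∀ x ∈ symmInterval a, 0 < x → φ x = 0) : L = 0 :=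
  ValueUpTo.eq_zero ha (h.congr ha hφ) fun _ _ _ _ hM => HasFinitePartFinite.eq_zero hM

/-- The finite part of a continuous function is its convergent integral. -/
lemma HasFinitePart.hasConvergentIntegral (ha : 0 < a) (h : HasFinitePart φ a L)
    (hφ : ContinuousOn φ (symmInterval a)) : HasConvergentIntegral φ a L := by
  refine ValueUpTo.mono ha h fun A hA hAa M hM => ?_
  have hi : IntervalIntegrable φ volume 0 A := by
    refine (hφ.mono fun x hx => ?_).intervalIntegrable
    rw [Set.uIcc_of_le hA.le] at hx
    exact mem_symmInterval_of_mem_Icc hAa ⟨by linarith [hx.1], hx.2⟩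
  exact ⟨hi, (HasFinitePartFinite.of_intervalIntegrable hi hA).unique hM hA⟩

lemma HasConvergentIntegral.congr (ha : 0 < a) (h : HasConvergentIntegral φ a L)
    (hφ : ∀ x ∈ symmInterval a, 0 < x → φ x = ψ x) : HasConvergentIntegral ψ a L := by
  refine ValueUpTo.mono ha h fun A hA hAa M hM => ?_
  have he : Set.EqOn φ ψ (Set.uIoc 0 A) := fun x hx => by
    rw [Set.uIoc_of_le hA.le] at hx
    exact hφ x (mem_symmInterval_of_mem_Ioc hAa hx) hx.1
  refine ⟨hM.1.congr he, ?_⟩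
  rw [← hM.2]
  exact intervalIntegral.integral_congr_ae (Eventually.of_forall fun x hx => (he hx).symm)

lemma HasConvergentIntegral.const_mul (h : HasConvergentIntegral φ a L) (z : ℂ) :
    HasConvergentIntegral (fun x => z * φ x) a (z * L) :=
  ValueUpTo.const_mul h z fun A M hM =>
    ⟨hM.1.const_mul z, by rw [intervalIntegral.integral_const_mul, hM.2]⟩

lemma HasConvergentIntegral.eq_zero (ha : 0 < a) (h : HasConvergentIntegral φ a L)
    (hφ : ∀ x ∈ symmInterval a, 0 < x → φ x = 0) : L = 0 :=
  ValueUpTo.eq_zero ha (h.congr ha hφ) fun _ _ _ _ hM => by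
    rw [← hM.2, intervalIntegral.integral_zero]

end

/-! ### Parity of indices and the special formulas -/

lemma HasSum.odd_of_even_eq_zero {F : ℕ → ℂ} {S : ℂ} (h : HasSum F S)
    (h0 : ∀ k, F (2 * k) = 0) : HasSum (fun k => F (2 * k + 1)) S := by
  refine (Function.Injective.hasSum_iff (g := fun k => 2 * k + 1)
    (fun i j hij => by simpa using hij) fun x hx => ?_).2 h
  rcases Nat.even_or_odd' x with ⟨j, rfl | rfl⟩
  · exact h0 j
  · exact absurd ⟨j, rfl⟩ hx

lemma sum_range_of_odd_eq_zero {G : ℕ → ℂ} (h : ∀ k, G (2 * k + 1) = 0) (m : ℕ) :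
    ∑ l ∈ Finset.range m, G l = ∑ i ∈ Finset.range ((m + 1) / 2), G (2 * i) := by
  have heven : ∀ p, ∑ l ∈ Finset.range (2 * p), G l = ∑ i ∈ Finset.range p, G (2 * i) := by
    intro p
    induction p with
    | zero => simp
    | succ p ih =>
      rw [show 2 * (p + 1) = 2 * p + 1 + 1 by ring, Finset.sum_range_succ, Finset.sum_range_succ,
        ih, h, add_zero, Finset.sum_range_succ]
  rcases Nat.even_or_odd' m with ⟨p, rfl | rfl⟩
  · rw [heven, show (2 * p + 1) / 2 = p by omega]
  · rw [Finset.sum_range_succ, heven, show (2 * p + 1 + 1) / 2 = p + 1 by omega,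
      Finset.sum_range_succ]

theorem theorem3 (a : WithTop ℝ) (ha : 0 < a) (f : ℝ → ℂ)
    (hf : ComplexAnalyticIn f (symmInterval a))
    -- for `a = ∞`, the principal value integrals are assumed to exist
    (hPV : a = ⊤ → ∀ ω : ℝ, ENNReal.ofReal |ω| < singularityRadius f (symmInterval a) →
      ∃ L : ℂ, HasPV f ω a L) :
    -- the general formula
    (∃ c : ℕ → ℂ,
      (∀ k : ℕ, HasFinitePart
        (fun x : ℝ => ((-1) ^ k * f (-x) - f x) / (x : ℂ) ^ (k + 1)) a (c k)) ∧
      ∀ ω : ℝ, ((|ω| : ℝ) : WithTop ℝ) < a →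
        ENNReal.ofReal |ω| < singularityRadius f (symmInterval a) →
        ∃ L : ℂ, HasPV f ω a L ∧ HasSum (fun k : ℕ => (ω : ℂ) ^ k * c k) L) ∧
    -- `f` even
    ((∀ x ∈ symmInterval a, f (-x) = f x) →
      ∃ c : ℕ → ℂ,
        (∀ k : ℕ, HasFinitePart (fun x : ℝ => f x / (x : ℂ) ^ (2 * k + 2)) a (c k)) ∧
        ∀ ω : ℝ, ((|ω| : ℝ) : WithTop ℝ) < a →
          ENNReal.ofReal |ω| < singularityRadius f (symmInterval a) →
          ∃ L S : ℂ, HasPV f ω a L ∧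
            HasSum (fun k : ℕ => (ω : ℂ) ^ (2 * k + 1) * c k) S ∧ L = -2 * S) ∧
    -- `f(x) = x ^ m g(x)`
    (∀ (m : ℕ) (g : ℝ → ℂ), 1 ≤ m → ComplexAnalyticIn g (symmInterval a) →
      (∀ x ∈ symmInterval a, f x = (x : ℂ) ^ m * g x) →
      ∃ c d : ℕ → ℂ,
        (∀ k < m, HasConvergentIntegral
          (fun x : ℝ => (x : ℂ) ^ (m - k - 1) * ((-1) ^ (k + m) * g (-x) - g x)) a (d k)) ∧
        (∀ k : ℕ, HasFinitePart
          (fun x : ℝ => ((-1) ^ k * g (-x) - g x) / (x : ℂ) ^ (k + 1)) a (c k)) ∧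
        ∀ ω : ℝ, ((|ω| : ℝ) : WithTop ℝ) < a →
          ENNReal.ofReal |ω| < singularityRadius f (symmInterval a) →
          ∃ L S : ℂ, HasPV f ω a L ∧
            HasSum (fun k : ℕ => (ω : ℂ) ^ (k + m) * c k) S ∧
            L = (∑ k ∈ Finset.range m, (ω : ℂ) ^ k * d k) + S) ∧
    -- `f(x) = x ^ m g(x)` with `g` even
    (∀ (m : ℕ) (g : ℝ → ℂ), 1 ≤ m → ComplexAnalyticIn g (symmInterval a) →
      (∀ x ∈ symmInterval a, f x = (x : ℂ) ^ m * g x) →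
      (∀ x ∈ symmInterval a, g (-x) = g x) →
      ∃ c d : ℕ → ℂ,
        (∀ k ≤ (m - 1) / 2, HasConvergentIntegral
          (fun x : ℝ => (x : ℂ) ^ (2 * ((m - 1) / 2) - 2 * k) * g x) a (d k)) ∧
        (∀ k : ℕ, HasFinitePart (fun x : ℝ => g x / (x : ℂ) ^ (2 * k + 2)) a (c k)) ∧
        ∀ ω : ℝ, ((|ω| : ℝ) : WithTop ℝ) < a →
          ENNReal.ofReal |ω| < singularityRadius f (symmInterval a) →
          ∃ L S : ℂ, HasPV f ω a L ∧
            HasSum (fun k : ℕ => (ω : ℂ) ^ (2 * k + m + 1) * c k) S ∧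
            L = -2 * S - 2 * ∑ k ∈ Finset.range ((m - 1) / 2 + 1),
              (ω : ℂ) ^ (2 * k + 1 + 2 * (m / 2) - m) * d k) ∧
    -- if `f` is entire and `a = ∞`, the condition on `ω` in the formulas holds for all real `ω`
    (∀ F : ℂ → ℂ, Differentiable ℂ F → (∀ x ∈ symmInterval a, F x = f x) → a = ⊤ →
      ∀ ω : ℝ, ((|ω| : ℝ) : WithTop ℝ) < a ∧
        ENNReal.ofReal |ω| < singularityRadius f (symmInterval a)) := by
  obtain ⟨c, hc, hsum⟩ := exists_hasFinitePart_and_hasPV ha hf hPV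
  -- No new expansion of `g` is needed: the coefficients of `f` are reread. For `k < m` the
  -- integrand is continuous at `0`, so its finite part is an ordinary integral; the rest are
  -- shifted by `m`.
  have hthird : ∀ (m : ℕ) (g : ℝ → ℂ), ComplexAnalyticIn g (symmInterval a) →
      (∀ x ∈ symmInterval a, f x = (x : ℂ) ^ m * g x) →
      (∀ k < m, HasConvergentIntegral
          (fun x : ℝ => (x : ℂ) ^ (m - k - 1) * ((-1) ^ (k + m) * g (-x) - g x)) a (c k)) ∧
      (∀ k : ℕ, HasFinitePart
          (fun x : ℝ => ((-1) ^ k * g (-x) - g x) / (x : ℂ) ^ (k + 1)) a (c (k + m))) := by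
    intro m g hg hfg
    have hsq : ∀ n : ℕ, ((-1 : ℂ) ^ n) * (-1) ^ n = 1 := fun n => by rw [← mul_pow]; simp
    refine ⟨fun k hk => ?_, fun k => ?_⟩
    · refine HasFinitePart.hasConvergentIntegral ha ((hc k).congr ha fun x hx hx0 => ?_) ?_
      · have hx' : (x : ℂ) ≠ 0 := by exact_mod_cast hx0.ne'
        obtain ⟨j, rfl⟩ := Nat.exists_eq_add_of_lt hk
        rw [hfg x hx, hfg (-x) (neg_mem_symmInterval hx), div_eq_iff (pow_ne_zero _ hx'),
          show k + j + 1 - k - 1 = j by omega, Complex.ofReal_neg, neg_pow (x : ℂ)]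
        ring
      · refine ContinuousOn.mul (by fun_prop) (ContinuousOn.sub (continuousOn_const.mul
          (hg.continuousOn.comp (by fun_prop) fun x hx => neg_mem_symmInterval hx))
          hg.continuousOn)
    · refine (hc (k + m)).congr ha fun x hx hx0 => ?_
      have hx' : (x : ℂ) ≠ 0 := by exact_mod_cast hx0.ne'
      rw [hfg x hx, hfg (-x) (neg_mem_symmInterval hx), div_eq_div_iff (pow_ne_zero _ hx')
        (pow_ne_zero _ hx'), Complex.ofReal_neg, neg_pow (x : ℂ), pow_add (-1 : ℂ)]
      linear_combination (-1) ^ k * (x : ℂ) ^ (m + k + 1) * g (-x) * hsq m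
  refine ⟨⟨c, hc, hsum⟩, fun heven => ?_, fun m g _ hg hfg => ?_, fun m g hm hg hfg heven => ?_,
    fun F hF hFf hatop ω => ?_⟩
  · have hc0 : ∀ k, c (2 * k) = 0 := fun k => (hc (2 * k)).eq_zero ha fun x hx _ => by
      rw [heven x hx, pow_mul]
      simp
    refine ⟨fun k => -(1 / 2) * c (2 * k + 1), fun k => ?_, fun ω hω hρ => ?_⟩
    · refine ((hc (2 * k + 1)).const_mul (-(1 / 2))).congr ha fun x hx _ => ?_
      rw [heven x hx, pow_succ, pow_mul]
      simp only [neg_one_sq, one_pow]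
      ring
    · obtain ⟨L, hL, hs⟩ := hsum ω hω hρ
      refine ⟨L, -(1 / 2) * L, hL, ?_, by ring⟩
      refine ((hs.odd_of_even_eq_zero fun k => by rw [hc0, mul_zero]).mul_left
        (-(1 / 2))).congr_fun fun k => ?_
      ring
  · obtain ⟨h1, h2⟩ := hthird m g hg hfg
    refine ⟨fun k => c (k + m), c, h1, h2, fun ω hω hρ => ?_⟩
    obtain ⟨L, hL, hs⟩ := hsum ω hω hρ
    exact ⟨L, _, hL, (hasSum_nat_add_iff' m).2 hs, by ring⟩
  · obtain ⟨h1, h2⟩ := hthird m g hg hfg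
    have hc0 : ∀ k, c (2 * k + m) = 0 := fun k => (h2 (2 * k)).eq_zero ha fun x hx _ => by
      rw [heven x hx, pow_mul]
      simp
    have hd0 : ∀ k < m, Even (k + m) → c k = 0 := fun k hk hkm => (h1 k hk).eq_zero ha
      fun x hx _ => by
        rw [heven x hx, hkm.neg_one_pow]
        ring
    refine ⟨fun k => -(1 / 2) * c (2 * k + 1 + m),
      -- The index solves `m - 1 - l = 2⌊(m-1)/2⌋ - 2k`; since `⌊m/2⌋ + ⌊(m-1)/2⌋ = m - 1`, it
      -- equals the exponent `2k + 1 + 2⌊m/2⌋ - m` of `ω`.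
      fun k => -(1 / 2) * c (m - 1 - (2 * ((m - 1) / 2) - 2 * k)), fun k hk => ?_, fun k => ?_,
      fun ω hω hρ => ?_⟩
    · refine ((h1 (m - 1 - (2 * ((m - 1) / 2) - 2 * k)) (by omega)).const_mul
        (-(1 / 2))).congr ha fun x hx _ => ?_
      have hodd : Odd (m - 1 - (2 * ((m - 1) / 2) - 2 * k) + m) := by
        rw [Nat.odd_iff]
        omega
      rw [heven x hx, hodd.neg_one_pow,
        show m - (m - 1 - (2 * ((m - 1) / 2) - 2 * k)) - 1 = 2 * ((m - 1) / 2) - 2 * k by omega]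
      ring
    · refine ((h2 (2 * k + 1)).const_mul (-(1 / 2))).congr ha fun x hx _ => ?_
      rw [heven x hx, pow_succ, pow_mul]
      simp only [neg_one_sq, one_pow]
      ring
    · obtain ⟨L, hL, hs⟩ := hsum ω hω hρ
      have hs' := (hasSum_nat_add_iff' m).2 hs
      refine ⟨L, _, hL, ((hs'.odd_of_even_eq_zero fun k => by rw [hc0, mul_zero]).mul_left
        (-(1 / 2))).congr_fun fun k => ?_, ?_⟩
      · rw [show 2 * k + m + 1 = 2 * k + 1 + m by ring]
        ring
      · have hfin : ∑ k ∈ Finset.range m, (ω : ℂ) ^ k * c k =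
            ∑ k ∈ Finset.range ((m - 1) / 2 + 1), (ω : ℂ) ^ (2 * k + 1 + 2 * (m / 2) - m) *
              c (m - 1 - (2 * ((m - 1) / 2) - 2 * k)) := by
          -- Reflected, the surviving terms have even `l`, for every `m`; the value `0` beyond `m`
          -- makes `G` vanish at all odd indices.
          set G : ℕ → ℂ := fun l => if l < m then (ω : ℂ) ^ (m - 1 - l) * c (m - 1 - l) else 0
            with hG
          have hGodd : ∀ k, G (2 * k + 1) = 0 := fun k => by
            simp only [hG]
            split_ifs with h
            · rw [hd0 _ (by omega) (by rw [Nat.even_iff]; omega), mul_zero]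
            · rfl
          rw [← Finset.sum_range_reflect, ← Finset.sum_range_reflect (n := (m - 1) / 2 + 1),
            Finset.sum_congr rfl (g := G) fun l hl => by
              simp only [hG]
              rw [if_pos (Finset.mem_range.1 hl)],
            sum_range_of_odd_eq_zero hGodd, show (m + 1) / 2 = (m - 1) / 2 + 1 by omega]
          refine Finset.sum_congr rfl fun i hi => ?_
          have hi' := Finset.mem_range.1 hi
          simp only [hG]
          rw [if_pos (by omega)]
          congr 2 <;> omega
        have hhalf : ∑ k ∈ Finset.range ((m - 1) / 2 + 1),
            (ω : ℂ) ^ (2 * k + 1 + 2 * (m / 2) - m) *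
              (-(1 / 2) * c (m - 1 - (2 * ((m - 1) / 2) - 2 * k))) =
            -(1 / 2) * ∑ k ∈ Finset.range m, (ω : ℂ) ^ k * c k := by
          rw [hfin, Finset.mul_sum]
          exact Finset.sum_congr rfl fun k _ => by ring
        rw [hhalf]
        ring
  · subst hatop
    refine ⟨WithTop.coe_lt_top _, ?_⟩
    have htop : singularityRadius f (symmInterval ⊤) = ⊤ := by
      refine ENNReal.eq_top_of_forall_nnreal_le fun r => ?_
      exact le_iSup₂_of_le r ⟨F, Set.univ, ⟨isOpen_univ, hF.differentiableOn,
        fun x hx => ⟨Set.mem_univ _, hFf x hx⟩⟩, Set.subset_univ _⟩ le_rfl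
    rw [htop]
    exact ENNReal.ofReal_lt_top
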